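/- All graphs are finite and simple. For a graph $G$ and a set $F\subseteq E(G)$ let $V(F)$ be the set of end-vertices of edges in $F$. Call $F$ *independent* if every non-empty $F'\subseteq F$ satisfies $|F'|\le 2|V(F')|-2$, with strict inequality when $|F'|=2$; these are the independent sets of the simple $(2,2)$-sparse matroid $\mathcal M^*_{2,2}(G)$. A graph $G$ without isolated vertices is an *$\mathcal M^*_{2,2}$-circuit* if $E(G)$ is a circuit of this matroid, i.e. $E(G)$ is not independent but all its proper subsets are. Let $K_5-e$ be the complete graph on five vertices minus an edge, let $H_1$ be the union of two copies of $K_4$ sharing exactly two vertices and the edge between them, and let $H_2$ be obtained from two copies of $K_4$ sharing exactly one vertex $w$ by adding one edge between a vertex $\ne w$ of the first copy and a vertex $\neq w$ of the second copy. A *2-vertex-separation* of $G$ is a pair of induced subgraphs $F_1=(V_1,E_1)$, $F_2=(V_2,E_2)$ of $G$ with $F_1\cup F_2=G$, $|V_1\cap V_2|=2$ and $V_1\setminus V_2\ne\emptyset\ne V_2\setminus V_1$; it is *nontrivial* if neither $F_1$ nor $F_2$ is a $K_4$. A *3-edge-separation* of $G$ is a pair of vertex-disjoint induced subgraphs $(F_1,F_2)$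 with $F_1\cup F_2=G-S$ for some $S\subseteq E(G)$ with $|S|=3$; it is *nontrivial* if no two edges of $S$ have a common end-vertex. A *1-extension* of a graph $H$ deletes an edge $xy$ of $H$ and adds a new vertex $v$ and three new edges $vx,vy,vz$ for some vertex $z\ne x,y$ of $H$; the inverse operation, from the resulting graph to $H$, is a *1-reduction* at $v$. A *node* is a vertex of degree three. A node $v$ of an $\mathcal M^*_{2,2}$-circuit $G$ is *admissible* if some 1-reduction of $G$ at $v$ produces an $\mathcal M^*_{2,2}$-circuit. **Theorem.** Let $G$ be an $\mathcal M^*_{2,2}$-circuit that is not isomorphic to $K_5-e$, $H_1$ or $H_2$, and suppose that $G$ has no nontrivial 2-vertex-separation and no nontrivial 3-edge-separation. Then $G$ has at least two admissible nodes. -/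

import Mathlib

/-- The set `V(F)` of end-vertices of a set `F` of edges. -/
def edgeSupport {V : Type*} (F : Set (Sym2 V)) : Set V :=
  {v | ∃ e ∈ F, v ∈ e}

/-- Independence in the simple `(2,2)`-sparse matroid: every nonempty `F' ⊆ F` satisfies
`|F'| ≤ 2 |V(F')| - 2`, with strict inequality when `|F'| = 2`. -/
def Indep22 {V : Type*} (F : Set (Sym2 V)) : Prop :=
  ∀ F' ⊆ F, F'.Nonempty →
    F'.ncard + 2 ≤ 2 * (edgeSupport F').ncard ∧
    (F'.ncard = 2 → F'.ncard + 2 < 2 * (edgeSupport F').ncard)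

/-- `G` is a circuit of the simple `(2,2)`-sparse matroid: its edge set is a minimal dependent
set, and `G` is the graph induced by this edge set, that is, it has no isolated vertices. -/
def IsCircuit22 {V : Type*} (G : SimpleGraph V) : Prop :=
  Minimal (fun F : Set (Sym2 V) => ¬ Indep22 F) G.edgeSet ∧ ∀ v, ∃ w, G.Adj v w

/-- The complete graph on five vertices minus one edge. -/
def K5e : SimpleGraph (Fin 5) :=
  (⊤ : SimpleGraph (Fin 5)).deleteEdges {s(2, 4)}

/-- Two copies of `K₄` sharing exactly an edge (here the edge `{0, 3}`). -/
def graphH1 : SimpleGraph (Fin 6) :=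
  SimpleGraph.fromEdgeSet
    {s(0, 1), s(0, 2), s(0, 3), s(1, 2), s(1, 3), s(2, 3),
     s(0, 4), s(0, 5), s(3, 4), s(3, 5), s(4, 5)}

/-- Two copies of `K₄` sharing exactly a vertex (here `3`), together with one edge (here `{0, 6}`)
joining them. -/
def graphH2 : SimpleGraph (Fin 7) :=
  SimpleGraph.fromEdgeSet
    {s(0, 1), s(0, 2), s(0, 3), s(1, 2), s(1, 3), s(2, 3),
     s(3, 4), s(3, 5), s(3, 6), s(4, 5), s(4, 6), s(5, 6),
     s(0, 6)}

/-- A `2`-vertex-separation: a pair of induced subgraphs with union `G` that have exactly two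
common vertices, neither vertex set containing the other. -/
def IsTwoVertexSeparation {V : Type*} (G : SimpleGraph V) (F₁ F₂ : G.Subgraph) : Prop :=
  F₁.IsInduced ∧ F₂.IsInduced ∧ F₁ ⊔ F₂ = ⊤ ∧
    (F₁.verts ∩ F₂.verts).ncard = 2 ∧
    (F₁.verts \ F₂.verts).Nonempty ∧ (F₂.verts \ F₁.verts).Nonempty

/-- A `2`-vertex-separation is nontrivial if neither side is a `K₄`. -/
def IsNontrivialTwoVertexSeparation {V : Type*} (G : SimpleGraph V)
    (F₁ F₂ : G.Subgraph) : Prop :=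
  IsTwoVertexSeparation G F₁ F₂ ∧
    IsEmpty (F₁.coe ≃g (⊤ : SimpleGraph (Fin 4))) ∧
    IsEmpty (F₂.coe ≃g (⊤ : SimpleGraph (Fin 4)))

/-- A `3`-edge-separation with deleted edge set `S`: a pair of vertex-disjoint induced subgraphs
whose union is `G - S`, where `S` is a set of three edges of `G`. -/
def IsThreeEdgeSeparation {V : Type*} (G : SimpleGraph V) (F₁ F₂ : G.Subgraph)
    (S : Set (Sym2 V)) : Prop :=
  F₁.IsInduced ∧ F₂.IsInduced ∧ Disjoint F₁.verts F₂.verts ∧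
    S ⊆ G.edgeSet ∧ S.ncard = 3 ∧ F₁ ⊔ F₂ = (⊤ : G.Subgraph).deleteEdges S

/-- A `3`-edge-separation is nontrivial if its three deleted edges are independent,
that is, no two of them have a common end-vertex. -/
def IsNontrivialThreeEdgeSeparation {V : Type*} (G : SimpleGraph V)
    (F₁ F₂ : G.Subgraph) : Prop :=
  ∃ S : Set (Sym2 V), IsThreeEdgeSeparation G F₁ F₂ S ∧
    S.Pairwise fun e f => ∀ v, ¬ (v ∈ e ∧ v ∈ f)

/-- A node is a vertex of degree three. -/
def IsNode {V : Type*} (G : SimpleGraph V) (v : V) : Prop :=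
  (G.neighborSet v).ncard = 3

/-- `G` is obtained from the graph `H` on `V ∖ {v}` by the `1`-extension that deletes an edge
`xy` of `H` and adds the new vertex `v` with the three edges `vx`, `vy`, `vz`, for some vertex
`z ≠ x, y`. Equivalently, `H` is obtained from `G` by a `1`-reduction at `v`. -/
def IsOneExtensionAt {V : Type*} (G : SimpleGraph V) (v : V)
    (H : SimpleGraph ↥({v}ᶜ : Set V)) : Prop :=
  ∃ x y z : ↥({v}ᶜ : Set V), H.Adj x y ∧ z ≠ x ∧ z ≠ y ∧
    G.induce ({v}ᶜ : Set V) = H.deleteEdges {s(x, y)} ∧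
    G.neighborSet v = {(x : V), (y : V), (z : V)}

/-- A node `v` is admissible if some `1`-reduction at `v` yields a (smaller) circuit. -/
def IsAdmissibleNode {V : Type*} (G : SimpleGraph V) (v : V) : Prop :=
  IsNode G v ∧ ∃ H : SimpleGraph ↥({v}ᶜ : Set V), IsOneExtensionAt G v H ∧ IsCircuit22 H

/-! ### Counting edges as ordered adjacent pairs. -/

section Counting

open Finset

variable {V : Type*}

/-! A circuit is a graph with 2|V| - 1 edges in which every nonempty proper vertex set X spans at
most 2|X| - 2 edges (`IsCircuit22.tightCircuit`, `TightCircuit.isCircuit22`). X is critical when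
equality holds; submodularity makes the union and intersection of two meeting critical sets critical
unless they cover V (`IsCritical.union_inter`). All degrees are at least three, the numbers 4 - deg
sum to 2 over V, and the nodes induce a forest.

A non-admissible node lies in a K₄, or else each pair of its neighbours is blocked by a critical
set, which makes it a flap node (`mem_clique_or_isFlapNode`). Nodes in K₄'s are harmless: K₄'s that
meet merge into maximal clique trees, which are critical and disjoint. As there are no nontrivial
separations, at least four edges leave each of them, so its deficiency is at most zero. Hence a set
that splits no maximal clique tree has deficiency at most the number of its nodes outside all K₄'s
(`deficiency_le`).

Suppose at most one node is admissible. Without non-admissible flap nodes, the total deficiency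
would give 2 ≤ 1. Otherwise the forest property yields a flap containing a non-node; let W be a
minimal one, belonging to v. The forest property again shows that W contains no non-admissible flap
node (`IsFlapNode.exists_node_neighbors`). Yet the deficiency of W is at least 2, so W splits a
maximal clique tree U. Splitting a leaf K₄ off U (`IsCliqueTree.exists_leaf`) gives a
2-vertex-separation that forces all vertices outside U, among them v, into one K₄
(`IsPrimeCircuit.exists_isNClique`). But a flap node lies in no K₄. -/

open Classical in
/-- The number of ordered adjacent pairs in `X × Y`. -/
noncomputable def adjCount (G : SimpleGraph V) (X Y : Finset V) : ℤ :=
  ∑ x ∈ X, ∑ y ∈ Y, if G.Adj x y then 1 else 0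

theorem adjCount_comm (G : SimpleGraph V) (X Y : Finset V) :
    adjCount G X Y = adjCount G Y X := by
  unfold adjCount
  rw [Finset.sum_comm]
  exact Finset.sum_congr rfl fun y _ => Finset.sum_congr rfl fun x _ => by rw [G.adj_comm]

theorem adjCount_nonneg (G : SimpleGraph V) (X Y : Finset V) : 0 ≤ adjCount G X Y :=
  Finset.sum_nonneg fun _ _ => Finset.sum_nonneg fun _ _ => by split_ifs <;> norm_num

theorem adjCount_mono (G : SimpleGraph V) {X X' Y Y' : Finset V} (hX : X ⊆ X') (hY : Y ⊆ Y') :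
    adjCount G X Y ≤ adjCount G X' Y' := by
  classical
  unfold adjCount
  calc _ ≤ ∑ x ∈ X, ∑ y ∈ Y', (if G.Adj x y then (1 : ℤ) else 0) :=
        Finset.sum_le_sum fun x _ => Finset.sum_le_sum_of_subset_of_nonneg hY fun _ _ _ => by
          split_ifs <;> norm_num
    _ ≤ _ := Finset.sum_le_sum_of_subset_of_nonneg hX fun _ _ _ =>
        Finset.sum_nonneg fun _ _ => by split_ifs <;> norm_num

theorem adjCount_pos (G : SimpleGraph V) {X Y : Finset V} {x y : V} (hx : x ∈ X) (hy : y ∈ Y)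
    (h : G.Adj x y) : 1 ≤ adjCount G X Y := by
  have := adjCount_mono G (Finset.singleton_subset_iff.2 hx) (Finset.singleton_subset_iff.2 hy)
  refine le_trans ?_ this
  rw [adjCount, Finset.sum_singleton, Finset.sum_singleton, if_pos h]

theorem not_adj_of_adjCount (G : SimpleGraph V) {X Y : Finset V} (h : adjCount G X Y ≤ 0)
    {x y : V} (hx : x ∈ X) (hy : y ∈ Y) : ¬ G.Adj x y := fun hxy => by
  have := adjCount_pos G hx hy hxy
  omega

theorem exists_adj_of_adjCount (G : SimpleGraph V) {X Y : Finset V} (h : 1 ≤ adjCount G X Y) :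
    ∃ x ∈ X, ∃ y ∈ Y, G.Adj x y := by
  by_contra! hn
  have : adjCount G X Y = 0 :=
    Finset.sum_eq_zero fun x hx => Finset.sum_eq_zero fun y hy => if_neg (hn x hx y hy)
  omega

@[simp] theorem adjCount_empty_right (G : SimpleGraph V) (Y : Finset V) :
    adjCount G Y ∅ = 0 := by simp [adjCount]

@[simp] theorem adjCount_singleton_self (G : SimpleGraph V) (v : V) :
    adjCount G {v} {v} = 0 := by simp [adjCount]

theorem adjCount_eq_sum (G : SimpleGraph V) (X Y : Finset V) :
    adjCount G X Y = ∑ x ∈ X, adjCount G {x} Y := by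
  simp [adjCount]

open Classical in
theorem adjCount_singleton (G : SimpleGraph V) (v : V) (Y : Finset V) :
    adjCount G {v} Y = #{y ∈ Y | G.Adj v y} := by
  simp [adjCount]

variable [DecidableEq V]

theorem adjCount_union_left (G : SimpleGraph V) {X X' : Finset V} (h : Disjoint X X')
    (Y : Finset V) : adjCount G (X ∪ X') Y = adjCount G X Y + adjCount G X' Y :=
  Finset.sum_union h

theorem adjCount_union_right (G : SimpleGraph V) {X X' : Finset V} (h : Disjoint X X')
    (Y : Finset V) : adjCount G Y (X ∪ X') = adjCount G Y X + adjCount G Y X' := by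
  rw [adjCount_comm, adjCount_union_left G h, adjCount_comm G X, adjCount_comm G X']

theorem adjCount_union_self (G : SimpleGraph V) {X Y : Finset V} (h : Disjoint X Y) :
    adjCount G (X ∪ Y) (X ∪ Y) = adjCount G X X + 2 * adjCount G X Y + adjCount G Y Y := by
  rw [adjCount_union_left G h, adjCount_union_right G h, adjCount_union_right G h,
    adjCount_comm G Y X]
  ring

theorem adjCount_insert_self (G : SimpleGraph V) {X : Finset V} {v : V} (h : v ∉ X) :
    adjCount G (insert v X) (insert v X) = adjCount G X X + 2 * adjCount G {v} X := by
  rw [Finset.insert_eq, adjCount_union_self G (by simpa using h)]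
  simp
  ring

theorem adjCount_union_inter (G : SimpleGraph V) (X Y : Finset V) :
    adjCount G (X ∪ Y) (X ∪ Y) + adjCount G (X ∩ Y) (X ∩ Y) =
      adjCount G X X + adjCount G Y Y + 2 * adjCount G (X \ Y) (Y \ X) := by
  have h1 : X ∪ Y = (X \ Y ∪ Y \ X) ∪ (X ∩ Y) := by ext; simp; tauto
  have h2 : X \ Y ∪ X ∩ Y = X := by ext; simp; tauto
  have h3 : Y \ X ∪ X ∩ Y = Y := by ext; simp; tauto
  have d1 : Disjoint (X \ Y ∪ Y \ X) (X ∩ Y) := by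
    rw [Finset.disjoint_left]; intro a; simp; tauto
  have d2 : Disjoint (X \ Y) (Y \ X) := by
    rw [Finset.disjoint_left]; intro a; simp; tauto
  have d3 : Disjoint (X \ Y) (X ∩ Y) := by
    rw [Finset.disjoint_left]; intro a; simp; tauto
  have d4 : Disjoint (Y \ X) (X ∩ Y) := by
    rw [Finset.disjoint_left]; intro a; simp; tauto
  have e1 := adjCount_union_self G d1
  have e2 := adjCount_union_self G d2
  have e3 := adjCount_union_self G d3
  have e4 := adjCount_union_self G d4
  rw [adjCount_union_left G d2 (X ∩ Y)] at e1
  rw [h2] at e3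
  rw [h3] at e4
  rw [← h1] at e1
  linarith

theorem adjCount_singleton_of_isClique (G : SimpleGraph V) {K : Finset V}
    (hK : G.IsClique (K : Set V)) {v : V} (hv : v ∈ K) : adjCount G {v} K = #K - 1 := by
  classical
  rw [adjCount_singleton]
  have : ({y ∈ K | G.Adj v y} : Finset V) = K.erase v := by
    ext y
    simp only [mem_filter, mem_erase]
    exact ⟨fun h => ⟨h.2.ne', h.1⟩, fun h => ⟨h.2, hK hv h.2 h.1.symm⟩⟩
  rw [this, Finset.card_erase_of_mem hv]
  have := Finset.card_pos.2 ⟨v, hv⟩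
  omega

theorem adjCount_self_of_isClique (G : SimpleGraph V) {K : Finset V}
    (hK : G.IsClique (K : Set V)) : adjCount G K K = #K * (#K - 1) := by
  rw [adjCount_eq_sum, Finset.sum_congr rfl fun v hv => adjCount_singleton_of_isClique G hK hv]
  simp [mul_sub]

end Counting

/-! ### Circuits of the matroid as an edge count on vertex sets. -/

section Bridge

open Finset

variable {V : Type*}

/-- This makes the strictness clause of `Indep22` automatic inside a simple graph, since 4 < 6; only
the plain (2,2)-count remains. -/
theorem three_le_ncard_edgeSupport (G : SimpleGraph V) {F : Set (Sym2 V)} (hF : F ⊆ G.edgeSet)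
    (h2 : F.ncard = 2) : 3 ≤ (edgeSupport F).ncard := by
  classical
  obtain ⟨e, f, hef, rfl⟩ := Set.ncard_eq_two.1 h2
  by_contra! hlt
  apply hef
  induction e with
  | _ a b =>
  induction f with
  | _ c d =>
  have hab : a ≠ b := (hF (Set.mem_insert _ _) : G.Adj a b).ne
  have hcd : c ≠ d := (hF (Set.mem_insert_of_mem _ rfl) : G.Adj c d).ne
  have hs : edgeSupport {s(a, b), s(c, d)} = (({a, b, c, d} : Finset V) : Set V) := by
    ext v
    simp [edgeSupport]
    tauto
  rw [hs, Set.ncard_coe_finset] at hlt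
  have key : ∀ t, t = c ∨ t = d → t = a ∨ t = b := by
    intro t ht
    by_contra! hn
    have : #({a, b, t} : Finset V) = 3 := Finset.card_eq_three.2 ⟨a, b, t, hab, hn.1.symm, hn.2.symm, rfl⟩
    have hle : #({a, b, t} : Finset V) ≤ #({a, b, c, d} : Finset V) := by
      apply Finset.card_le_card
      intro z
      simp
      rcases ht with rfl | rfl <;> tauto
    omega
  have h1 := key c (Or.inl rfl)
  have h2 := key d (Or.inr rfl)
  rw [Sym2.eq_iff]
  rcases h1 with rfl | rfl <;> rcases h2 with rfl | rfl <;> simp_all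

variable [Fintype V]

/-- The edges of `G` with both ends in `X`. -/
def edgesIn (G : SimpleGraph V) (X : Finset V) : Set (Sym2 V) :=
  {e ∈ G.edgeSet | ∀ v ∈ e, v ∈ X}

theorem two_mul_ncard_edgesIn (G : SimpleGraph V) (X : Finset V) :
    2 * ((edgesIn G X).ncard : ℤ) = adjCount G X X := by
  classical
  let H : SimpleGraph V :=
    { Adj := fun a b => G.Adj a b ∧ a ∈ X ∧ b ∈ X
      symm := ⟨fun a b h => ⟨h.1.symm, h.2.2, h.2.1⟩⟩
      loopless := ⟨fun a h => G.loopless.irrefl a h.1⟩ }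
  have hE : edgesIn G X = H.edgeSet := by
    ext e
    induction e with
    | _ a b => simp [edgesIn, H]
  have h := H.sum_degrees_eq_twice_card_edges
  rw [hE, ← SimpleGraph.coe_edgeFinset, Set.ncard_coe_finset]
  have h' : (2 * (#H.edgeFinset : ℤ)) = ∑ v, (H.degree v : ℤ) := by exact_mod_cast h.symm
  rw [h', adjCount]
  rw [← Finset.sum_subset (Finset.subset_univ X)]
  · refine Finset.sum_congr rfl fun x hx => ?_
    rw [← SimpleGraph.card_neighborFinset_eq_degree, SimpleGraph.neighborFinset_eq_filter]
    simp only [Finset.sum_boole, Nat.cast_inj]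
    congr 1
    ext y
    simp [H, hx]
    tauto
  · intro v _ hv
    rw [← SimpleGraph.card_neighborFinset_eq_degree, SimpleGraph.neighborFinset_eq_filter]
    simp [H, hv]

/-- The degree-count formulation of `IsCircuit22`. -/
structure TightCircuit (G : SimpleGraph V) : Prop where
  total : adjCount G univ univ = 4 * Fintype.card V - 2
  sparse : ∀ X : Finset V, X.Nonempty → X ≠ univ → adjCount G X X ≤ 4 * #X - 4

theorem edgesIn_univ (G : SimpleGraph V) : edgesIn G univ = G.edgeSet := by
  simp [edgesIn]

/-- By minimality only the full edge set violates the count, while deleting one edge leaves an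
independent set; together these fix the number of edges. Having no isolated vertices makes V(E) = V,
and makes the edges inside a proper vertex set a proper subset of E. -/
theorem IsCircuit22.tightCircuit {G : SimpleGraph V} (hG : IsCircuit22 G) : TightCircuit G := by
  classical
  obtain ⟨hmin, hiso⟩ := hG
  have hproper : ∀ F ⊂ G.edgeSet, Indep22 F := by
    intro F hF
    by_contra hn
    exact hF.2 (hmin.2 hn hF.1)
  have hsupp : edgeSupport G.edgeSet = Set.univ := by
    ext v
    obtain ⟨w, hw⟩ := hiso v
    simp only [edgeSupport, Set.mem_ofPred_eq, Set.mem_univ, iff_true]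
    exact ⟨s(v, w), hw, by simp⟩
  have hbig : 2 * Fintype.card V ≤ G.edgeSet.ncard + 1 ∧ G.edgeSet.Nonempty := by
    have h1 := hmin.1
    simp only [Indep22] at h1
    push Not at h1
    obtain ⟨F', hF', hne, h⟩ := h1
    have hFE : F' = G.edgeSet := by
      by_contra hn
      have := hproper F' (lt_of_le_of_ne hF' hn) F' le_rfl hne
      obtain ⟨h3, h4⟩ := this
      obtain ⟨h5, h6⟩ := h h3
      have := h4 h5
      omega
    subst hFE
    refine ⟨?_, hne⟩
    by_cases hc : G.edgeSet.ncard + 2 ≤ 2 * (edgeSupport G.edgeSet).ncard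
    · have := h hc
      have h3 := three_le_ncard_edgeSupport G le_rfl this.1
      omega
    · rw [hsupp, Set.ncard_univ, Nat.card_eq_fintype_card] at hc
      omega
  have hsmall : G.edgeSet.ncard + 1 ≤ 2 * Fintype.card V := by
    obtain ⟨e, he⟩ := hbig.2
    have hF : G.edgeSet \ {e} ⊂ G.edgeSet := Set.sdiff_singleton_ssubset.2 he
    have hcard : (G.edgeSet \ {e}).ncard + 1 = G.edgeSet.ncard :=
      Set.ncard_sdiff_singleton_add_one he
    by_cases hne : (G.edgeSet \ {e}).Nonempty
    · have := (hproper _ hF _ le_rfl hne).1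
      have h2 : (edgeSupport (G.edgeSet \ {e})).ncard ≤ Fintype.card V := by
        rw [← Nat.card_eq_fintype_card, ← Set.ncard_univ]
        exact Set.ncard_le_ncard (Set.subset_univ _)
      omega
    · rw [Set.not_nonempty_iff_eq_empty] at hne
      rw [hne, Set.ncard_empty] at hcard
      obtain ⟨v⟩ : Nonempty V := ⟨e.out.1⟩
      have := Fintype.card_pos_iff.2 ⟨v⟩
      omega
  constructor
  · rw [← two_mul_ncard_edgesIn, edgesIn_univ]
    omega
  · intro X hX hXu
    rw [← two_mul_ncard_edgesIn]
    have hpos := hX.card_pos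
    by_cases hne : (edgesIn G X).Nonempty
    · have hss : edgesIn G X ⊂ G.edgeSet := by
        refine ⟨fun e he => he.1, fun hle => hXu ?_⟩
        ext v
        obtain ⟨w, hw⟩ := hiso v
        have := (hle (show s(v, w) ∈ G.edgeSet from hw)).2 v (by simp)
        simpa using this
      have h1 := (hproper _ hss _ le_rfl hne).1
      have h2 : (edgeSupport (edgesIn G X)).ncard ≤ #X := by
        rw [← Set.ncard_coe_finset]
        refine Set.ncard_le_ncard ?_ (Set.toFinite _)
        rintro v ⟨e, he, hv⟩
        exact he.2 v hv
      omega
    · rw [Set.not_nonempty_iff_eq_empty] at hne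
      rw [hne, Set.ncard_empty]
      push_cast
      omega

/-- A violating edge set F' contradicts sparsity at V(F') unless V(F') = V, and then it has at least
2|V| - 1 edges, that is, all of them. -/
theorem TightCircuit.isCircuit22 {G : SimpleGraph V} (hG : TightCircuit G) : IsCircuit22 G := by
  classical
  have htot := hG.total
  have hE := two_mul_ncard_edgesIn G univ
  rw [edgesIn_univ, htot] at hE
  have hne : G.edgeSet.Nonempty := by
    by_contra h
    rw [Set.not_nonempty_iff_eq_empty] at h
    rw [h, Set.ncard_empty] at hE
    push_cast at hE
    omega
  have hsub : ∀ F ⊆ G.edgeSet, ¬ Indep22 F → G.edgeSet ⊆ F := by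
    intro F hF hd
    simp only [Indep22] at hd
    push Not at hd
    obtain ⟨F', hF', hne', h⟩ := hd
    have hF'E := hF'.trans hF
    have hgt : 2 * (edgeSupport F').ncard < F'.ncard + 2 := by
      by_contra! hle
      have := h hle
      have := three_le_ncard_edgeSupport G hF'E this.1
      omega
    have hXc : ((edgeSupport F').toFinset : Set V) = edgeSupport F' := by simp
    have hle : F' ⊆ edgesIn G (edgeSupport F').toFinset := fun e he =>
      ⟨hF'E he, fun v hv => by simpa using ⟨e, he, hv⟩⟩
    have hcard : F'.ncard ≤ (edgesIn G (edgeSupport F').toFinset).ncard :=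
      Set.ncard_le_ncard hle (Set.toFinite _)
    have hX : (edgeSupport F').ncard = #(edgeSupport F').toFinset := by
      rw [← Set.ncard_coe_finset, hXc]
    have h2 := two_mul_ncard_edgesIn G (edgeSupport F').toFinset
    obtain ⟨e, he⟩ := hne'
    by_cases hXu : (edgeSupport F').toFinset = univ
    · rw [hXu, Finset.card_univ] at hX
      have : F' = G.edgeSet := Set.eq_of_subset_of_ncard_le hF'E (by omega) (Set.toFinite _)
      exact this ▸ hF'
    · have hXne : (edgeSupport F').toFinset.Nonempty :=
        ⟨e.out.1, by simpa using ⟨e, he, Sym2.out_fst_mem e⟩⟩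
      have := hG.sparse _ hXne hXu
      omega
  have hdep : ¬ Indep22 G.edgeSet := by
    intro hi
    have := (hi _ le_rfl hne).1
    have h2 : (edgeSupport G.edgeSet).ncard ≤ Fintype.card V := by
      rw [← Nat.card_eq_fintype_card, ← Set.ncard_univ]
      exact Set.ncard_le_ncard (Set.subset_univ _)
    omega
  refine ⟨⟨hdep, fun F hF hle => hsub F hle hF⟩, fun v => ?_⟩
  have hins : insert v (univ.erase v) = univ := Finset.insert_erase (mem_univ v)
  have h1 := adjCount_insert_self G (Finset.notMem_erase v univ)
  rw [hins, htot] at h1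
  have hc : #(univ.erase v) + 1 = Fintype.card V := Finset.card_erase_add_one (mem_univ v)
  have hpos : 1 ≤ adjCount G {v} (univ.erase v) := by
    by_cases hne' : (univ.erase v).Nonempty
    · have := hG.sparse _ hne' (fun h => by simpa using (Finset.ext_iff.1 h v))
      omega
    · rw [Finset.not_nonempty_iff_eq_empty] at hne'
      rw [hne'] at h1 hc
      simp at h1 hc
      omega
  obtain ⟨x, hx, y, _, hxy⟩ := exists_adj_of_adjCount G hpos
  rw [Finset.mem_singleton] at hx
  exact ⟨y, hx ▸ hxy⟩

end Bridge

/-! ### Critical sets and degree deficiency. -/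

section Critical

open Finset

variable {V : Type*}

/-- A critical set: the induced subgraph has `2|X| - 2` edges. -/
def IsCritical (G : SimpleGraph V) (X : Finset V) : Prop :=
  X.Nonempty ∧ adjCount G X X = 4 * #X - 4

theorem SimpleGraph.IsNClique.isCritical {G : SimpleGraph V} {K : Finset V}
    (hK : G.IsNClique 4 K) : IsCritical G K := by
  classical
  refine ⟨Finset.card_pos.1 (by rw [hK.card_eq]; norm_num), ?_⟩
  rw [adjCount_self_of_isClique G hK.isClique, hK.card_eq]
  norm_num

variable [Fintype V] {G : SimpleGraph V}

theorem IsCritical.ne_univ (hG : TightCircuit G) {X : Finset V} (hX : IsCritical G X) :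
    X ≠ univ := by
  rintro rfl
  have h1 := hX.2
  have h2 := hG.total
  rw [Finset.card_univ] at h1
  omega

theorem TightCircuit.eq_univ (hG : TightCircuit G) {X : Finset V} (hX : X.Nonempty)
    (h : 4 * #X - 4 < adjCount G X X) : X = univ := by
  by_contra hn
  have := hG.sparse X hX hn
  omega

variable [DecidableEq V]

omit [Fintype V] in
theorem card_union_add_card_inter_int (X Y : Finset V) :
    (#(X ∪ Y) : ℤ) + #(X ∩ Y) = #X + #Y := by
  exact_mod_cast Finset.card_union_add_card_inter X Y

/-- Both bounds for the union and the intersection add up to exactly what X and Y contribute, so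
both are tight and no edge between the differences has room. -/
theorem IsCritical.union_inter (hG : TightCircuit G) {X Y : Finset V} (hX : IsCritical G X)
    (hY : IsCritical G Y) (hne : (X ∩ Y).Nonempty) (hu : X ∪ Y ≠ univ) :
    IsCritical G (X ∪ Y) ∧ IsCritical G (X ∩ Y) ∧ adjCount G (X \ Y) (Y \ X) = 0 := by
  have hi : X ∩ Y ≠ univ := fun h => hu (by
    rw [eq_univ_iff_forall] at h ⊢
    exact fun x => mem_union_left _ (mem_inter.1 (h x)).1)
  have h1 := hG.sparse _ hne hi
  have h2 := hG.sparse _ (hX.1.mono subset_union_left) hu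
  have h3 := adjCount_union_inter G X Y
  have h4 := card_union_add_card_inter_int X Y
  have h5 := hX.2
  have h6 := hY.2
  have h7 := adjCount_nonneg G (X \ Y) (Y \ X)
  exact ⟨⟨hX.1.mono subset_union_left, by omega⟩, ⟨hne, by omega⟩, by omega⟩

/-- If two meeting critical sets cover everything, their intersection is critical as soon as there
is an edge between their differences, and then there is just one such edge. -/
theorem IsCritical.inter_of_cover (hG : TightCircuit G) {X Y : Finset V} (hX : IsCritical G X)
    (hY : IsCritical G Y) (hne : (X ∩ Y).Nonempty) (hu : X ∪ Y = univ)
    (hd : 1 ≤ adjCount G (X \ Y) (Y \ X)) :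
    IsCritical G (X ∩ Y) ∧ adjCount G (X \ Y) (Y \ X) = 1 := by
  have hi : X ∩ Y ≠ univ := fun h => hX.ne_univ hG (by
    rw [eq_univ_iff_forall] at h ⊢
    exact fun x => (mem_inter.1 (h x)).1)
  have h1 := hG.sparse _ hne hi
  have h2 := hG.total
  have h3 := adjCount_union_inter G X Y
  have h4 := card_union_add_card_inter_int X Y
  have h5 := hX.2
  have h6 := hY.2
  rw [hu, Finset.card_univ] at h4
  rw [hu] at h3
  -- The whole graph exceeds the critical value by one edge. One edge between the differences uses
  -- this up: the bound at the intersection is tight and no second edge fits.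
  exact ⟨⟨hne, by omega⟩, by omega⟩

omit [Fintype V] in
theorem card_insert_int {X : Finset V} {v : V} (hv : v ∉ X) :
    (#(insert v X) : ℤ) = #X + 1 := by
  rw [Finset.card_insert_of_notMem hv]
  push_cast
  rfl

theorem IsCritical.insert_eq_univ (hG : TightCircuit G) {X : Finset V} (hX : IsCritical G X)
    {v : V} (hv : v ∉ X) (h : 3 ≤ adjCount G {v} X) : insert v X = univ := by
  refine hG.eq_univ (insert_nonempty v X) ?_
  rw [adjCount_insert_self G hv, card_insert_int hv]
  have := hX.2
  omega

omit [Fintype V] in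
theorem IsCritical.insert {X : Finset V} (hX : IsCritical G X)
    {v : V} (hv : v ∉ X) (h : adjCount G {v} X = 2) : IsCritical G (insert v X) := by
  refine ⟨insert_nonempty v X, ?_⟩
  rw [adjCount_insert_self G hv, card_insert_int hv]
  have := hX.2
  omega

omit [Fintype V] in
theorem IsCritical.of_insert {X : Finset V} {v : V} (hv : v ∉ X)
    (hX : IsCritical G (Insert.insert v X)) (hne : X.Nonempty) (h : adjCount G {v} X = 2) :
    IsCritical G X := by
  refine ⟨hne, ?_⟩
  have h1 := hX.2
  rw [adjCount_insert_self G hv, card_insert_int hv] at h1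
  omega

/-- A critical set is connected. -/
theorem IsCritical.exists_adj (hG : TightCircuit G) {U D : Finset V} (hU : IsCritical G U)
    (hD : D ⊂ U) (hne : D.Nonempty) : ∃ a ∈ D, ∃ b ∈ U \ D, G.Adj a b := by
  -- Without an edge between them, D and U \ D would together span at most 4|U| - 8 ordered pairs,
  -- short of 4|U| - 4.
  apply exists_adj_of_adjCount
  have hdisj : Disjoint D (U \ D) := disjoint_sdiff
  have h1 := adjCount_union_self G hdisj
  rw [union_sdiff_of_subset hD.1] at h1
  have hne' : (U \ D).Nonempty := sdiff_nonempty.2 hD.2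
  have hUu := hU.ne_univ hG
  have h2 := hG.sparse D hne fun h => hUu (univ_subset_iff.1 (h ▸ hD.1))
  have h3 := hG.sparse (U \ D) hne' fun h => hUu (univ_subset_iff.1 (h ▸ sdiff_subset))
  have h4 := hU.2
  have h5 : #(U \ D) + #D = #U := card_sdiff_add_card_eq_card hD.1
  omega

theorem adjCount_erase (G : SimpleGraph V) (v : V) :
    adjCount G {v} univ = adjCount G {v} (univ.erase v) := by
  have h := adjCount_union_right G (X := {v}) (X' := univ.erase v) (by simp) {v}
  rw [← Finset.insert_eq, Finset.insert_erase (mem_univ v)] at h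
  rw [h, adjCount_singleton_self, zero_add]

/-- Of the 2n - 1 edges at most 2(n - 1) - 2 survive the deletion of a vertex. -/
theorem TightCircuit.three_le_degree (hG : TightCircuit G) (v : V) :
    3 ≤ adjCount G {v} univ := by
  have hv := Finset.notMem_erase v univ
  have h1 := adjCount_insert_self G hv
  have hc := card_insert_int hv
  rw [Finset.insert_erase (mem_univ v)] at h1 hc
  rw [hG.total] at h1
  have h2 := adjCount_erase G v
  rw [Finset.card_univ] at hc
  have hne : (univ.erase v).Nonempty := by
    by_contra h
    rw [not_nonempty_iff_eq_empty] at h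
    rw [h] at h1 hc
    simp at h1 hc
    omega
  have := hG.sparse _ hne fun h => hv (by rw [h]; exact mem_univ v)
  omega

theorem adjCount_compl (G : SimpleGraph V) (X Y : Finset V) :
    adjCount G X Y + adjCount G X Yᶜ = adjCount G X univ := by
  rw [← adjCount_union_right G disjoint_compl_right, union_compl]

theorem card_compl_int (X : Finset V) : (#Xᶜ : ℤ) = Fintype.card V - #X := by
  have := Finset.card_add_card_compl X
  omega

theorem adjCount_self_compl (hG : TightCircuit G) (X : Finset V) :
    adjCount G X X + 2 * adjCount G X Xᶜ + adjCount G Xᶜ Xᶜ = 4 * Fintype.card V - 2 := by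
  rw [← adjCount_union_self G disjoint_compl_right, union_compl, hG.total]

/-- Total degree deficiency of `Y` with respect to degree four. -/
noncomputable def deficiency (G : SimpleGraph V) (Y : Finset V) : ℤ :=
  ∑ v ∈ Y, (4 - adjCount G {v} univ)

omit [DecidableEq V] in
theorem deficiency_eq (G : SimpleGraph V) (Y : Finset V) :
    deficiency G Y = 4 * #Y - adjCount G Y univ := by
  rw [adjCount_eq_sum, deficiency, Finset.sum_sub_distrib]
  simp [mul_comm]

omit [DecidableEq V] in
theorem TightCircuit.deficiency_univ (hG : TightCircuit G) : deficiency G univ = 2 := by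
  rw [deficiency_eq, hG.total, Finset.card_univ]
  ring

/-- With `IsCritical.deficiency_compl`, this turns a lower bound on the edges leaving X into an
upper bound on the deficiency of X and a lower bound on that of its complement. -/
theorem IsCritical.deficiency {X : Finset V} (hX : IsCritical G X) :
    deficiency G X = 4 - adjCount G X Xᶜ := by
  rw [deficiency_eq, ← adjCount_compl G X X, hX.2]
  ring

theorem IsCritical.deficiency_compl (hG : TightCircuit G) {X : Finset V} (hX : IsCritical G X) :
    _root_.deficiency G Xᶜ = adjCount G X Xᶜ - 2 := by
  rw [deficiency_eq, ← adjCount_compl G Xᶜ Xᶜ, compl_compl, adjCount_comm G Xᶜ X,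
    card_compl_int]
  have := adjCount_self_compl hG X
  have := hX.2
  linarith

end Critical

/-! ### Nodes induce a forest. -/

section Nodes

open Finset

variable {V : Type*} [Fintype V] [DecidableEq V] {G : SimpleGraph V}

omit [DecidableEq V] in
theorem isNode_iff {v : V} : IsNode G v ↔ adjCount G {v} univ = 3 := by
  classical
  rw [IsNode, adjCount_singleton]
  have : G.neighborSet v = (({y | G.Adj v y} : Finset V) : Set V) := by ext; simp
  rw [this, Set.ncard_coe_finset]
  norm_cast

omit [Fintype V] [DecidableEq V] in
theorem IsNode.exists_neighbors {v : V} (hv : IsNode G v) :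
    ∃ x y z, x ≠ y ∧ x ≠ z ∧ y ≠ z ∧ ∀ w, G.Adj v w ↔ w = x ∨ w = y ∨ w = z := by
  obtain ⟨x, y, z, h1, h2, h3, h⟩ := Set.ncard_eq_three.1 hv
  refine ⟨x, y, z, h1, h2, h3, fun w => ?_⟩
  rw [← SimpleGraph.mem_neighborSet, h]
  simp

omit [Fintype V] [DecidableEq V] in
theorem adjCount_singleton_eq_card (G : SimpleGraph V) {v : V} {X T : Finset V}
    (h : ∀ w ∈ X, G.Adj v w ↔ w ∈ T) (hT : T ⊆ X) : adjCount G {v} X = #T := by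
  classical
  rw [adjCount_singleton]
  congr 2
  ext w
  simp only [mem_filter]
  exact ⟨fun hw => (h w hw.1).1 hw.2, fun hw => ⟨hT hw, (h w (hT hw)).2 hw⟩⟩

/-- Nodes induce a forest. -/
theorem TightCircuit.forest (hG : TightCircuit G) {S : Finset V} (hS : ∀ v ∈ S, IsNode G v)
    (hne : S.Nonempty) : adjCount G S S ≤ 2 * #S - 2 := by
  have h1 := adjCount_compl G S S
  have h2 : adjCount G S univ = 3 * #S := by
    rw [adjCount_eq_sum, Finset.sum_congr rfl fun v hv => isNode_iff.1 (hS v hv)]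
    simp [mul_comm]
  have h3 := adjCount_self_compl hG S
  have h4 := card_compl_int S
  by_cases hu : Sᶜ.Nonempty
  · have := hG.sparse Sᶜ hu fun h => by simp at h; simp [h] at hne
    omega
  -- If all vertices are nodes, then 3n = 4n - 2 gives n = 2, too few for degree three.
  · rw [not_nonempty_iff_eq_empty] at hu
    have hSu : S = univ := by simpa using hu
    subst hSu
    rw [hG.total, Finset.card_univ] at h2
    rw [hu] at h3
    rw [hG.total, Finset.card_univ]
    have := hG.three_le_degree
    obtain ⟨v, -⟩ := hne
    have h5 := this v
    have : adjCount G {v} univ ≤ #(univ : Finset V) - 1 := by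
      have hv := Finset.notMem_erase v univ
      have hc := card_insert_int hv
      have h2 := adjCount_erase G v
      rw [Finset.insert_erase (mem_univ v)] at hc
      classical
      rw [h2, adjCount_singleton, hc]
      rw [add_sub_cancel_right]
      exact_mod_cast Finset.card_filter_le _ _
    rw [Finset.card_univ] at this
    omega

end Nodes

/-! ### When a 1-reduction gives a circuit. -/

section Reduction

open Finset

variable {V : Type*} [Fintype V] [DecidableEq V] {G : SimpleGraph V}

omit [Fintype V] [DecidableEq V] in
theorem adjCount_induce_sup_edge (G : SimpleGraph V) (s : Set V) {x y : s} (hxy : x ≠ y)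
    (hn : ¬ G.Adj x y) (X : Finset s) [Decidable (x ∈ X ∧ y ∈ X)] :
    adjCount (G.induce s ⊔ SimpleGraph.edge x y) X X =
      adjCount G (X.map (Function.Embedding.subtype _)) (X.map (Function.Embedding.subtype _)) +
        if x ∈ X ∧ y ∈ X then 2 else 0 := by
  classical
  have key : ∀ (a b : s) [Decidable ((G.induce s ⊔ SimpleGraph.edge x y).Adj a b)]
      [Decidable (G.Adj a b)], (if (G.induce s ⊔ SimpleGraph.edge x y).Adj a b then (1 : ℤ) else 0) =
      (if G.Adj a b then 1 else 0) + (if a = x then (if b = y then 1 else 0) else 0)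
        + (if a = y then (if b = x then 1 else 0) else 0) := by
    intro a b _ _
    simp only [SimpleGraph.sup_adj, SimpleGraph.edge_adj]
    have hn' : ¬ G.Adj y x := fun h => hn h.symm
    by_cases hax : a = x
    · subst hax
      by_cases hby : b = y
      · subst hby
        simp [hn, hxy]
      · simp [hby, hxy]
    · by_cases hay : a = y
      · subst hay
        by_cases hbx : b = x
        · subst hbx
          simp [hn', hxy.symm, hxy]
        · simp [hbx, hax]
      · simp [hax, hay]
  have hmap : adjCount G (X.map (Function.Embedding.subtype _))
      (X.map (Function.Embedding.subtype _)) = ∑ a ∈ X, ∑ b ∈ X, if G.Adj a b then 1 else 0 := by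
    unfold adjCount
    rw [Finset.sum_map]
    refine Finset.sum_congr rfl fun a _ => ?_
    rw [Finset.sum_map]
    exact Finset.sum_congr rfl fun b _ => if_congr Iff.rfl rfl rfl
  rw [hmap]
  unfold adjCount
  simp only [key, Finset.sum_add_distrib, Finset.sum_ite_eq', Finset.sum_ite_irrel,
    Finset.sum_const_zero]
  by_cases h1 : x ∈ X <;> by_cases h2 : y ∈ X <;> simp [h1, h2]
  ring

/-- A node is admissible if it has two nonadjacent neighbours that lie in no common critical set
avoiding the node, other than the set of all other vertices. -/
theorem isAdmissibleNode_of (hG : TightCircuit G) {v x y z : V} (hxy : x ≠ y) (hxz : x ≠ z)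
    (hyz : y ≠ z) (hN : ∀ w, G.Adj v w ↔ w = x ∨ w = y ∨ w = z) (hn : ¬ G.Adj x y)
    (hX : ∀ X : Finset V, v ∉ X → x ∈ X → y ∈ X → IsCritical G X → insert v X = univ) :
    IsAdmissibleNode G v := by
  classical
  have hvx : v ≠ x := ((hN x).2 (by simp)).ne
  have hvy : v ≠ y := ((hN y).2 (by simp)).ne
  have hvz : v ≠ z := ((hN z).2 (by simp)).ne
  have hnode : IsNode G v := by
    refine Set.ncard_eq_three.2 ⟨x, y, z, hxy, hxz, hyz, ?_⟩
    ext w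
    simp [hN]
  let x' : ↥({v}ᶜ : Set V) := ⟨x, hvx.symm⟩
  let y' : ↥({v}ᶜ : Set V) := ⟨y, hvy.symm⟩
  let z' : ↥({v}ᶜ : Set V) := ⟨z, hvz.symm⟩
  have hx'y' : x' ≠ y' := fun h => hxy (congrArg Subtype.val h)
  have hn' : ¬ G.Adj (x' : V) (y' : V) := hn
  have hcard : (Fintype.card ↥({v}ᶜ : Set V) : ℤ) = Fintype.card V - 1 := by
    have h1 : Fintype.card ↥({v}ᶜ : Set V) = Fintype.card V - 1 := by
      rw [Fintype.card_compl_set]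
      simp
    have := Fintype.card_pos_iff.2 ⟨v⟩
    omega
  have hmap : ∀ X : Finset ↥({v}ᶜ : Set V), v ∉ X.map (Function.Embedding.subtype _) := by
    intro X h
    simp at h
  have hmapu : ∀ X : Finset ↥({v}ᶜ : Set V),
      insert v (X.map (Function.Embedding.subtype _)) = univ → X = univ := by
    intro X h
    ext w
    have := Finset.ext_iff.1 h w
    have hw : (w : V) ≠ v := w.2
    simpa [hw] using this
  have hdeg : adjCount G {v} (univ.erase v) = 3 := by
    rw [adjCount_singleton_eq_card G (T := {x, y, z})]
    · rw [Finset.card_eq_three.2 ⟨x, y, z, hxy, hxz, hyz, rfl⟩]; rfl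
    · simp [hN]
    · intro w; simp; rintro (rfl | rfl | rfl) <;> simp_all [ne_comm]
  refine ⟨hnode, G.induce _ ⊔ SimpleGraph.edge x' y', ⟨x', y', z', ?_, ?_, ?_, ?_, ?_⟩, ?_⟩
  · simp [SimpleGraph.edge_adj, hx'y']
  · exact fun h => hxz (congrArg Subtype.val h).symm
  · exact fun h => hyz (congrArg Subtype.val h).symm
  · ext a b
    simp only [SimpleGraph.deleteEdges_adj, SimpleGraph.sup_adj, SimpleGraph.edge_adj,
      Set.mem_singleton_iff, SimpleGraph.comap_adj, Function.Embedding.subtype_apply, Sym2.eq_iff]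
    constructor
    · intro h
      refine ⟨Or.inl h, ?_⟩
      rintro (⟨rfl, rfl⟩ | ⟨rfl, rfl⟩)
      · exact hn h
      · exact hn h.symm
    · rintro ⟨h | h, h'⟩
      · exact h
      · exact absurd h.1 (by tauto)
  · ext w
    simp [hN, x', y', z']
  · apply TightCircuit.isCircuit22
    constructor
    · rw [adjCount_induce_sup_edge G _ hx'y' hn', if_pos (by simp)]
      have h1 : (univ : Finset ↥({v}ᶜ : Set V)).map (Function.Embedding.subtype _) =
          univ.erase v := by
        ext w
        simp
      rw [h1, hcard]
      have h2 := adjCount_insert_self G (Finset.notMem_erase v univ)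
      rw [Finset.insert_erase (mem_univ v), hG.total, hdeg] at h2
      omega
    · intro X hXne hXu
      rw [adjCount_induce_sup_edge G _ hx'y' hn']
      have hne : (X.map (Function.Embedding.subtype _)).Nonempty := by simpa using hXne
      have hlt := hG.sparse _ hne fun h => hmap X (h ▸ mem_univ v)
      rw [← Finset.card_map (Function.Embedding.subtype _)]
      split_ifs with h
      · have hnc : ¬ IsCritical G (X.map (Function.Embedding.subtype _)) := fun hc =>
          hXu (hmapu X (hX _ (hmap X) (by simpa using ⟨hvx.symm, h.1⟩)
            (by simpa using ⟨hvy.symm, h.2⟩) hc))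
        have h3 : adjCount G (X.map (Function.Embedding.subtype _))
            (X.map (Function.Embedding.subtype _)) ≠
            4 * #(X.map (Function.Embedding.subtype _)) - 4 := fun h => hnc ⟨hne, h⟩
        -- The count is even, so a set that is not critical falls short by at least two ordered
        -- pairs, just what the new edge xy adds.
        have h4 := two_mul_ncard_edgesIn G (X.map (Function.Embedding.subtype _))
        omega
      · omega

end Reduction

/-! ### The separation hypotheses in terms of vertex sets. -/

section Separations

open Finset

variable {V : Type*} [Fintype V] [DecidableEq V] {G : SimpleGraph V}

omit [Fintype V] [DecidableEq V] in
theorem isNClique_of_iso_top {n : ℕ} {X : Finset V}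
    (φ : ((⊤ : G.Subgraph).induce (X : Set V)).coe ≃g (⊤ : SimpleGraph (Fin n))) :
    G.IsNClique n X := by
  refine ⟨fun a ha b hb hab => ?_, ?_⟩
  · have h := φ.map_adj_iff (v := ⟨a, ha⟩) (w := ⟨b, hb⟩)
    rw [SimpleGraph.top_adj] at h
    have h2 := h.1 fun h => hab (congrArg Subtype.val (φ.injective h))
    exact ((⊤ : G.Subgraph).induce (X : Set V)).adj_sub h2
  · have h := Nat.card_congr φ.toEquiv
    rw [Nat.card_fin] at h
    rw [← h, ← Set.ncard_coe_finset]
    rfl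

theorem isNClique_of_no_two_separation
    (hvert : ¬ ∃ F₁ F₂ : G.Subgraph, IsNontrivialTwoVertexSeparation G F₁ F₂)
    {X Y : Finset V} (hu : X ∪ Y = univ) (hi : #(X ∩ Y) = 2)
    (hXY : ∀ a ∉ Y, ∀ b ∉ X, ¬ G.Adj a b) (hX : ∃ a, a ∉ Y) (hY : ∃ b, b ∉ X) :
    G.IsNClique 4 X ∨ G.IsNClique 4 Y := by
  by_contra hcon
  rw [not_or] at hcon
  apply hvert
  have hmem : ∀ a, a ∈ X ∨ a ∈ Y := fun a => mem_union.1 (hu ▸ mem_univ a)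
  refine ⟨(⊤ : G.Subgraph).induce (X : Set V), (⊤ : G.Subgraph).induce (Y : Set V),
    ⟨?_, ?_, ?_, ?_, ?_, ?_⟩, ⟨fun φ => hcon.1 (isNClique_of_iso_top φ)⟩,
    ⟨fun φ => hcon.2 (isNClique_of_iso_top φ)⟩⟩
  · intro a ha b hb hab
    simpa using ⟨ha, hb, hab⟩
  · intro a ha b hb hab
    simpa using ⟨ha, hb, hab⟩
  · ext a b
    · simpa using hmem a
    · simp only [SimpleGraph.Subgraph.sup_adj, SimpleGraph.Subgraph.induce_adj, mem_coe,
        SimpleGraph.Subgraph.top_adj]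
      refine ⟨by tauto, fun hab => ?_⟩
      have h1 := hmem a
      have h2 := hmem b
      have h3 := fun h => hXY a h b
      have h4 := fun h => hXY b h a
      have h5 := hab.symm
      tauto
  · simp only [SimpleGraph.Subgraph.induce_verts]
    rw [← Finset.coe_inter, Set.ncard_coe_finset, hi]
  · obtain ⟨a, ha⟩ := hX
    exact ⟨a, by simpa [ha] using (hmem a).resolve_right ha⟩
  · obtain ⟨b, hb⟩ := hY
    exact ⟨b, by simpa [hb] using (hmem b).resolve_left hb⟩

/-- Two of the three cut edges share an end. This end, together with the end of the third edge on
the opposite side, covers the cut. -/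
theorem exists_cover_of_no_three_separation
    (hedge : ¬ ∃ F₁ F₂ : G.Subgraph, IsNontrivialThreeEdgeSeparation G F₁ F₂)
    {X : Finset V} (hX : adjCount G X Xᶜ = 3) :
    ∃ x ∈ X, ∃ y ∉ X, ∀ a ∈ X, ∀ b ∉ X, G.Adj a b → a = x ∨ b = y := by
  classical
  let P : Finset (V × V) := {p ∈ X ×ˢ Xᶜ | G.Adj p.1 p.2}
  have hP : #P = 3 := by
    have : adjCount G X Xᶜ = #P := by
      unfold adjCount
      rw [← Finset.sum_product', Finset.sum_boole]
    omega
  have hmemP : ∀ a b, (a, b) ∈ P ↔ a ∈ X ∧ b ∉ X ∧ G.Adj a b := by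
    intro a b
    simp [P, and_assoc]
  let S : Finset (Sym2 V) := P.image fun p => s(p.1, p.2)
  have hinj : Set.InjOn (fun p : V × V => s(p.1, p.2)) P := by
    rintro ⟨a, b⟩ h1 ⟨a', b'⟩ h2 h
    have h1' := (hmemP a b).1 h1
    have h2' := (hmemP a' b').1 h2
    rcases Sym2.eq_iff.1 h with h | h
    · exact Prod.ext h.1 h.2
    · exact absurd h2'.1 ((show b = a' from h.2) ▸ h1'.2.1)
  have hS : #S = 3 := by rw [Finset.card_image_of_injOn hinj, hP]
  have hmemS : ∀ a b, s(a, b) ∈ S ↔ G.Adj a b ∧ ((a ∈ X ∧ b ∉ X) ∨ (b ∈ X ∧ a ∉ X)) := by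
    intro a b
    simp only [S, mem_image, Prod.exists, hmemP, Sym2.eq_iff]
    constructor
    · rintro ⟨c, d, h, ⟨rfl, rfl⟩ | ⟨rfl, rfl⟩⟩
      · tauto
      · exact ⟨h.2.2.symm, by tauto⟩
    · rintro ⟨h, h' | h'⟩
      · exact ⟨a, b, by tauto, by tauto⟩
      · exact ⟨b, a, ⟨h'.1, h'.2, h.symm⟩, by tauto⟩
  have hnot : ¬ (S : Set (Sym2 V)).Pairwise fun e f => ∀ v, ¬ (v ∈ e ∧ v ∈ f) := by
    intro hpw
    apply hedge
    refine ⟨(⊤ : G.Subgraph).induce (X : Set V), (⊤ : G.Subgraph).induce (Xᶜ : Set V), S,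
      ⟨?_, ?_, ?_, ?_, ?_, ?_⟩, hpw⟩
    · intro a ha b hb hab
      simpa using ⟨ha, hb, hab⟩
    · intro a ha b hb hab
      simpa using ⟨ha, hb, hab⟩
    · exact disjoint_compl_right
    · intro e he
      induction e with
      | _ a b => exact ((hmemS a b).1 he).1
    · rw [Set.ncard_coe_finset, hS]
    · ext a b
      · simp
      · simp only [SimpleGraph.Subgraph.sup_adj, SimpleGraph.Subgraph.induce_adj, mem_coe,
          SimpleGraph.Subgraph.top_adj, SimpleGraph.Subgraph.deleteEdges_adj, hmemS,
          Set.mem_compl_iff]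
        tauto
  simp only [Set.Pairwise] at hnot
  push Not at hnot
  obtain ⟨e, he, f, hf, hef, v, hve, hvf⟩ := hnot
  obtain ⟨p, hp, rfl⟩ := mem_image.1 (mem_coe.1 he)
  obtain ⟨q, hq, rfl⟩ := mem_image.1 (mem_coe.1 hf)
  have hpq : p ≠ q := fun h => hef (h ▸ rfl)
  obtain ⟨r, hr⟩ : ∃ r, (P.erase p).erase q = {r} := by
    rw [← Finset.card_eq_one, Finset.card_erase_of_mem (mem_erase.2 ⟨hpq.symm, hq⟩),
      Finset.card_erase_of_mem hp, hP]
  have hall : ∀ t ∈ P, t = p ∨ t = q ∨ t = r := by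
    intro t ht
    by_contra! hn
    have : t ∈ (P.erase p).erase q := mem_erase.2 ⟨hn.2.1, mem_erase.2 ⟨hn.1, ht⟩⟩
    rw [hr, mem_singleton] at this
    exact hn.2.2 this
  have hrP : r ∈ P := mem_of_mem_erase (mem_of_mem_erase (hr ▸ mem_singleton_self r))
  have hp' := (hmemP p.1 p.2).1 hp
  have hq' := (hmemP q.1 q.2).1 hq
  have hr' := (hmemP r.1 r.2).1 hrP
  have hshare : p.1 = q.1 ∨ p.2 = q.2 := by
    rw [Sym2.mem_iff] at hve hvf
    rcases hve with h1 | h1 <;> rcases hvf with h2 | h2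
    · exact Or.inl (h1 ▸ h2)
    · exact absurd hp'.1 ((h1.symm.trans h2) ▸ hq'.2.1)
    · exact absurd hq'.1 ((h2.symm.trans h1) ▸ hp'.2.1)
    · exact Or.inr (h1 ▸ h2)
  rcases hshare with h | h
  · refine ⟨p.1, hp'.1, r.2, hr'.2.1, fun a ha b hb hab => ?_⟩
    rcases hall (a, b) ((hmemP a b).2 ⟨ha, hb, hab⟩) with h' | h' | h'
    · exact Or.inl (congrArg Prod.fst h')
    · exact Or.inl ((congrArg Prod.fst h').trans h.symm)
    · exact Or.inr (congrArg Prod.snd h')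
  · refine ⟨r.1, hr'.1, p.2, hp'.2.1, fun a ha b hb hab => ?_⟩
    rcases hall (a, b) ((hmemP a b).2 ⟨ha, hb, hab⟩) with h' | h' | h'
    · exact Or.inr (congrArg Prod.snd h')
    · exact Or.inr ((congrArg Prod.snd h').trans h.symm)
    · exact Or.inl (congrArg Prod.fst h')

end Separations

/-! ### Recognising the three exceptional graphs. -/

section SmallGraphs

open Finset

variable {V : Type*} [Fintype V] [DecidableEq V] {G : SimpleGraph V}

-- A surjection between sets of equal size is bijective, and the edge count excludes edges beyond
-- the images, so only the edges of the model graph need checking.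
omit [DecidableEq V] in
theorem nonempty_iso_of_edges_le {k : ℕ} (H : SimpleGraph (Fin k)) (f : Fin k → V)
    (hf : Function.Surjective f) (hk : Fintype.card V = k)
    (hom : ∀ e ∈ H.edgeSet, e.map f ∈ G.edgeSet)
    (hcard : G.edgeSet.ncard ≤ H.edgeSet.ncard) : Nonempty (G ≃g H) := by
  have hbij : Function.Bijective f :=
    (Fintype.bijective_iff_surjective_and_card f).2 ⟨hf, by simpa using hk.symm⟩
  have himg : Sym2.map f '' H.edgeSet = G.edgeSet := by
    refine Set.eq_of_subset_of_ncard_le ?_ ?_ (Set.toFinite _)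
    · rintro _ ⟨e, he, rfl⟩
      exact hom e he
    · rwa [Set.ncard_image_of_injective _ (Sym2.map.injective hbij.1)]
  refine ⟨SimpleGraph.Iso.symm ⟨Equiv.ofBijective f hbij, fun {a b} => ?_⟩⟩
  change s(f a, f b) ∈ G.edgeSet ↔ s(a, b) ∈ H.edgeSet
  rw [← himg, ← Sym2.map_mk, (Sym2.map.injective hbij.1).mem_set_image]

theorem ncard_K5e : K5e.edgeSet.ncard = 9 := by
  have : K5e.edgeSet = ((univ.filter fun e : Sym2 (Fin 5) => ¬ e.IsDiag ∧ e ≠ s(2, 4)) :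
      Set (Sym2 (Fin 5))) := by
    ext e
    simp [K5e, SimpleGraph.edgeSet_deleteEdges]
  rw [this, Set.ncard_coe_finset]
  decide

theorem edgeSet_graphH1 : graphH1.edgeSet = (({s(0, 1), s(0, 2), s(0, 3), s(1, 2), s(1, 3),
    s(2, 3), s(0, 4), s(0, 5), s(3, 4), s(3, 5), s(4, 5)} : Finset (Sym2 (Fin 6))) :
      Set (Sym2 (Fin 6))) := by
  rw [graphH1, SimpleGraph.edgeSet_fromEdgeSet]
  ext e
  simp only [Set.mem_sdiff, coe_insert, coe_singleton]
  refine ⟨fun h => h.1, fun h => ⟨h, ?_⟩⟩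
  rcases h with h | h | h | h | h | h | h | h | h | h | h <;> subst h <;> simp

theorem ncard_graphH1 : graphH1.edgeSet.ncard = 11 := by
  rw [edgeSet_graphH1, Set.ncard_coe_finset]
  decide

theorem edgeSet_graphH2 : graphH2.edgeSet = (({s(0, 1), s(0, 2), s(0, 3), s(1, 2), s(1, 3),
    s(2, 3), s(3, 4), s(3, 5), s(3, 6), s(4, 5), s(4, 6), s(5, 6), s(0, 6)} :
      Finset (Sym2 (Fin 7))) : Set (Sym2 (Fin 7))) := by
  rw [graphH2, SimpleGraph.edgeSet_fromEdgeSet]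
  ext e
  simp only [Set.mem_sdiff, coe_insert, coe_singleton]
  refine ⟨fun h => h.1, fun h => ⟨h, ?_⟩⟩
  rcases h with h | h | h | h | h | h | h | h | h | h | h | h | h <;> subst h <;> simp

theorem ncard_graphH2 : graphH2.edgeSet.ncard = 13 := by
  rw [edgeSet_graphH2, Set.ncard_coe_finset]
  decide

omit [DecidableEq V] in
theorem TightCircuit.ncard_edgeSet (hG : TightCircuit G) :
    (G.edgeSet.ncard : ℤ) = 2 * Fintype.card V - 1 := by
  have h := two_mul_ncard_edgesIn G univ
  rw [edgesIn_univ, hG.total] at h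
  omega

/-- Cliques on four vertices share at most one vertex. -/
theorem card_inter_le_one (hG : TightCircuit G) (hK : IsEmpty (G ≃g K5e))
    (h1 : IsEmpty (G ≃g graphH1)) {K L : Finset V} (hKc : G.IsNClique 4 K)
    (hLc : G.IsNClique 4 L) (hKL : K ≠ L) : #(K ∩ L) ≤ 1 := by
  by_contra! hlt
  have hle : #(K ∩ L) ≤ 3 := by
    by_contra! h
    have e1 := Finset.eq_of_subset_of_card_le (inter_subset_left (s₁ := K) (s₂ := L))
      (by rw [hKc.card_eq]; omega)
    have e2 := Finset.eq_of_subset_of_card_le (inter_subset_right (s₁ := K) (s₂ := L))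
      (by rw [hLc.card_eq]; omega)
    exact hKL (e1.symm.trans e2)
  have hcl : G.IsClique ((K ∩ L : Finset V) : Set V) :=
    hKc.isClique.subset (by simp)
  have d1 := adjCount_self_of_isClique G hcl
  have d2 := adjCount_union_inter G K L
  have d3 := hKc.isCritical.2
  have d4 := hLc.isCritical.2
  have d5 := adjCount_nonneg G (K \ L) (L \ K)
  have d6 := card_union_add_card_inter_int K L
  have cK := hKc.card_eq
  have cL := hLc.card_eq
  have cKL := Finset.card_sdiff_add_card_inter K L
  have cLK := Finset.card_sdiff_add_card_inter L K
  rw [Finset.inter_comm L K] at cLK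
  have hne : (K ∪ L).Nonempty := hKc.isCritical.1.mono subset_union_left
  have adjK : ∀ a ∈ K, ∀ b ∈ K, a ≠ b → G.Adj a b := fun a ha b hb => hKc.isClique ha hb
  have adjL : ∀ a ∈ L, ∀ b ∈ L, a ≠ b → G.Adj a b := fun a ha b hb => hLc.isClique ha hb
  rw [cK, cL] at d6
  rw [cK] at d3
  rw [cL] at d4
  obtain hc | hc : #(K ∩ L) = 2 ∨ #(K ∩ L) = 3 := by omega
  -- Two common vertices: the union has 6 vertices and at least 11 edges, so it is everything and G
  -- is H₁.
  · rw [hc] at d1 d6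
    have hu : K ∪ L = univ := hG.eq_univ hne (by omega)
    have hcard : Fintype.card V = 6 := by
      rw [hu, Finset.card_univ] at d6
      omega
    obtain ⟨p, q, hpq, hi⟩ := Finset.card_eq_two.1 hc
    obtain ⟨a, b, hab, hKd⟩ := Finset.card_eq_two.1 (show #(K \ L) = 2 by omega)
    obtain ⟨c, d, hcd, hLd⟩ := Finset.card_eq_two.1 (show #(L \ K) = 2 by omega)
    have hp : p ∈ K ∧ p ∈ L := mem_inter.1 (by rw [hi]; simp)
    have hq : q ∈ K ∧ q ∈ L := mem_inter.1 (by rw [hi]; simp)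
    have ha : a ∈ K ∧ a ∉ L := mem_sdiff.1 (by rw [hKd]; simp)
    have hb : b ∈ K ∧ b ∉ L := mem_sdiff.1 (by rw [hKd]; simp)
    have hc' : c ∈ L ∧ c ∉ K := mem_sdiff.1 (by rw [hLd]; simp)
    have hd : d ∈ L ∧ d ∉ K := mem_sdiff.1 (by rw [hLd]; simp)
    have ne : ∀ {s t : V} {L : Finset V}, s ∈ L → t ∉ L → s ≠ t := fun hs ht h => ht (h ▸ hs)
    obtain ⟨φ⟩ := nonempty_iso_of_edges_le (G := G) graphH1 ![p, a, b, q, c, d] (by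
        intro w
        have hw : w ∈ (K ∩ L) ∪ (K \ L) ∪ (L \ K) := by
          have : w ∈ K ∪ L := hu ▸ mem_univ w
          simp only [mem_union, mem_inter, mem_sdiff] at this ⊢
          tauto
        rw [hi, hKd, hLd] at hw
        simp only [mem_union, mem_insert, mem_singleton] at hw
        rcases hw with ((rfl | rfl) | (rfl | rfl)) | (rfl | rfl)
        exacts [⟨0, rfl⟩, ⟨3, rfl⟩, ⟨1, rfl⟩, ⟨2, rfl⟩, ⟨4, rfl⟩, ⟨5, rfl⟩]) hcard (by
        rw [edgeSet_graphH1]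
        simp only [coe_insert, coe_singleton]
        rintro e (rfl | rfl | rfl | rfl | rfl | rfl | rfl | rfl | rfl | rfl | rfl)
        · exact adjK p hp.1 a ha.1 (ne hp.2 ha.2)
        · exact adjK p hp.1 b hb.1 (ne hp.2 hb.2)
        · exact adjK p hp.1 q hq.1 hpq
        · exact adjK a ha.1 b hb.1 hab
        · exact adjK a ha.1 q hq.1 (ne hq.2 ha.2).symm
        · exact adjK b hb.1 q hq.1 (ne hq.2 hb.2).symm
        · exact adjL p hp.2 c hc'.1 (ne hp.1 hc'.2)
        · exact adjL p hp.2 d hd.1 (ne hp.1 hd.2)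
        · exact adjL q hq.2 c hc'.1 (ne hq.1 hc'.2)
        · exact adjL q hq.2 d hd.1 (ne hq.1 hd.2)
        · exact adjL c hc'.1 d hd.1 hcd) (by
        rw [ncard_graphH1]
        have := hG.ncard_edgeSet
        omega)
    exact h1.elim φ
  -- Three common vertices: the union has 5 vertices and at least 9 edges, so G is K₅ - e.
  · rw [hc] at d1 d6
    have hu : K ∪ L = univ := hG.eq_univ hne (by omega)
    have hcard : Fintype.card V = 5 := by
      rw [hu, Finset.card_univ] at d6
      omega
    obtain ⟨p, q, r, hpq, hpr, hqr, hi⟩ := Finset.card_eq_three.1 hc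
    obtain ⟨a, hKd⟩ := Finset.card_eq_one.1 (show #(K \ L) = 1 by omega)
    obtain ⟨b, hLd⟩ := Finset.card_eq_one.1 (show #(L \ K) = 1 by omega)
    have hp : p ∈ K ∧ p ∈ L := mem_inter.1 (by rw [hi]; simp)
    have hq : q ∈ K ∧ q ∈ L := mem_inter.1 (by rw [hi]; simp)
    have hr : r ∈ K ∧ r ∈ L := mem_inter.1 (by rw [hi]; simp)
    have ha : a ∈ K ∧ a ∉ L := mem_sdiff.1 (by rw [hKd]; simp)
    have hb : b ∈ L ∧ b ∉ K := mem_sdiff.1 (by rw [hLd]; simp)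
    have ne : ∀ {s t : V} {L : Finset V}, s ∈ L → t ∉ L → s ≠ t := fun hs ht h => ht (h ▸ hs)
    have hpa := adjK p hp.1 a ha.1 (ne hp.2 ha.2)
    have hqa := adjK q hq.1 a ha.1 (ne hq.2 ha.2)
    have hra := adjK r hr.1 a ha.1 (ne hr.2 ha.2)
    have hpb := adjL p hp.2 b hb.1 (ne hp.1 hb.2)
    have hqb := adjL q hq.2 b hb.1 (ne hq.1 hb.2)
    have hrb := adjL r hr.2 b hb.1 (ne hr.1 hb.2)
    have hpq' := adjK p hp.1 q hq.1 hpq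
    have hpr' := adjK p hp.1 r hr.1 hpr
    have hqr' := adjK q hq.1 r hr.1 hqr
    obtain ⟨φ⟩ := nonempty_iso_of_edges_le (G := G) K5e ![p, q, a, r, b] (by
        intro w
        have hw : w ∈ (K ∩ L) ∪ (K \ L) ∪ (L \ K) := by
          have : w ∈ K ∪ L := hu ▸ mem_univ w
          simp only [mem_union, mem_inter, mem_sdiff] at this ⊢
          tauto
        rw [hi, hKd, hLd] at hw
        simp only [mem_union, mem_insert, mem_singleton] at hw
        rcases hw with ((rfl | rfl | rfl) | rfl) | rfl
        exacts [⟨0, rfl⟩, ⟨1, rfl⟩, ⟨3, rfl⟩, ⟨2, rfl⟩, ⟨4, rfl⟩]) hcard (by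
        intro e
        induction e with
        | _ i j =>
        rw [Sym2.map_mk, SimpleGraph.mem_edgeSet, SimpleGraph.mem_edgeSet]
        fin_cases i <;> fin_cases j <;> simp [K5e, *, G.adj_comm]) (by
        rw [ncard_K5e]
        have := hG.ncard_edgeSet
        omega)
    exact hK.elim φ

/-- Two cliques on four vertices that share one vertex do not cover the graph. -/
theorem union_ne_univ (hG : TightCircuit G) (h2 : IsEmpty (G ≃g graphH2)) {K L : Finset V}
    (hKc : G.IsNClique 4 K) (hLc : G.IsNClique 4 L) (hc : #(K ∩ L) = 1) : K ∪ L ≠ univ := by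
  intro hu
  obtain ⟨w, hi⟩ := Finset.card_eq_one.1 hc
  have d2 := adjCount_union_inter G K L
  have d3 := hKc.isCritical.2
  have d4 := hLc.isCritical.2
  have d6 := card_union_add_card_inter_int K L
  have cK := hKc.card_eq
  have cL := hLc.card_eq
  have cKL := Finset.card_sdiff_add_card_inter K L
  have cLK := Finset.card_sdiff_add_card_inter L K
  rw [Finset.inter_comm L K] at cLK
  have htot := hG.total
  rw [hi, hu, adjCount_singleton_self] at d2
  rw [cK, cL, hc, hu, Finset.card_univ] at d6
  have hcard : Fintype.card V = 7 := by omega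
  have adjK : ∀ a ∈ K, ∀ b ∈ K, a ≠ b → G.Adj a b := fun a ha b hb => hKc.isClique ha hb
  have adjL : ∀ a ∈ L, ∀ b ∈ L, a ≠ b → G.Adj a b := fun a ha b hb => hLc.isClique ha hb
  -- On 7 vertices there are 13 edges, and the cliques supply 12; the last one joins their
  -- differences.
  obtain ⟨a, haK, b, hbL, hab⟩ := exists_adj_of_adjCount G
    (show 1 ≤ adjCount G (K \ L) (L \ K) by omega)
  obtain ⟨a1, a2, ha12, hA⟩ := Finset.card_eq_two.1 (show #((K \ L).erase a) = 2 by
    rw [Finset.card_erase_of_mem haK]; omega)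
  obtain ⟨b1, b2, hb12, hB⟩ := Finset.card_eq_two.1 (show #((L \ K).erase b) = 2 by
    rw [Finset.card_erase_of_mem hbL]; omega)
  have hw : w ∈ K ∧ w ∈ L := mem_inter.1 (by rw [hi]; simp)
  have ha1 : a1 ≠ a ∧ a1 ∈ K ∧ a1 ∉ L := by
    simpa using (show a1 ∈ (K \ L).erase a by rw [hA]; simp)
  have ha2 : a2 ≠ a ∧ a2 ∈ K ∧ a2 ∉ L := by
    simpa using (show a2 ∈ (K \ L).erase a by rw [hA]; simp)
  have hb1 : b1 ≠ b ∧ b1 ∈ L ∧ b1 ∉ K := by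
    simpa using (show b1 ∈ (L \ K).erase b by rw [hB]; simp)
  have hb2 : b2 ≠ b ∧ b2 ∈ L ∧ b2 ∉ K := by
    simpa using (show b2 ∈ (L \ K).erase b by rw [hB]; simp)
  rw [mem_sdiff] at haK hbL
  have ne : ∀ {s t : V} {L : Finset V}, s ∈ L → t ∉ L → s ≠ t := fun hs ht h => ht (h ▸ hs)
  obtain ⟨φ⟩ := nonempty_iso_of_edges_le (G := G) graphH2 ![a, a1, a2, w, b1, b2, b] (by
      intro t
      have ht : t = a ∨ t ∈ (K \ L).erase a ∨ t ∈ K ∩ L ∨ t ∈ (L \ K).erase b ∨ t = b := by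
        have : t ∈ K ∪ L := hu ▸ mem_univ t
        simp only [mem_union, mem_inter, mem_sdiff, mem_erase] at this ⊢
        tauto
      rw [hi, hA, hB] at ht
      simp only [mem_insert, mem_singleton] at ht
      rcases ht with rfl | (rfl | rfl) | rfl | (rfl | rfl) | rfl
      exacts [⟨0, rfl⟩, ⟨1, rfl⟩, ⟨2, rfl⟩, ⟨3, rfl⟩, ⟨4, rfl⟩, ⟨5, rfl⟩, ⟨6, rfl⟩]) hcard (by
      rw [edgeSet_graphH2]
      simp only [coe_insert, coe_singleton]
      rintro e (rfl | rfl | rfl | rfl | rfl | rfl | rfl | rfl | rfl | rfl | rfl | rfl | rfl)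
      · exact adjK a haK.1 a1 ha1.2.1 ha1.1.symm
      · exact adjK a haK.1 a2 ha2.2.1 ha2.1.symm
      · exact adjK a haK.1 w hw.1 (ne hw.2 haK.2).symm
      · exact adjK a1 ha1.2.1 a2 ha2.2.1 ha12
      · exact adjK a1 ha1.2.1 w hw.1 (ne hw.2 ha1.2.2).symm
      · exact adjK a2 ha2.2.1 w hw.1 (ne hw.2 ha2.2.2).symm
      · exact adjL w hw.2 b1 hb1.2.1 (ne hw.1 hb1.2.2)
      · exact adjL w hw.2 b2 hb2.2.1 (ne hw.1 hb2.2.2)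
      · exact adjL w hw.2 b hbL.1 (ne hw.1 hbL.2)
      · exact adjL b1 hb1.2.1 b2 hb2.2.1 hb12
      · exact adjL b1 hb1.2.1 b hbL.1 hb1.1
      · exact adjL b2 hb2.2.1 b hbL.1 hb2.1
      · exact hab) (by
      rw [ncard_graphH2]
      have := hG.ncard_edgeSet
      omega)
  exact h2.elim φ

end SmallGraphs

/-! ### Clique trees and the deficiency bound. -/

section Good

open Finset

variable {V : Type*} [Fintype V] [DecidableEq V] {G : SimpleGraph V}

/-- The consequences, in terms of vertex sets, of being a circuit without nontrivial separations
that is none of the three exceptional graphs. -/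
structure IsPrimeCircuit (G : SimpleGraph V) : Prop where
  tight : TightCircuit G
  sep : ∀ X Y : Finset V, X ∪ Y = univ → #(X ∩ Y) = 2 → (∀ a ∉ Y, ∀ b ∉ X, ¬ G.Adj a b) →
    (∃ a, a ∉ Y) → (∃ b, b ∉ X) → G.IsNClique 4 X ∨ G.IsNClique 4 Y
  cut : ∀ X : Finset V, adjCount G X Xᶜ = 3 →
    ∃ x ∈ X, ∃ y ∉ X, ∀ a ∈ X, ∀ b ∉ X, G.Adj a b → a = x ∨ b = y
  inter : ∀ K L : Finset V, G.IsNClique 4 K → G.IsNClique 4 L → K ≠ L → #(K ∩ L) ≤ 1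
  union : ∀ K L : Finset V, G.IsNClique 4 K → G.IsNClique 4 L → #(K ∩ L) = 1 → K ∪ L ≠ univ

/-- In such a clique y would have three neighbours in X, which forces X ∪ {y} = V. -/
theorem IsCritical.not_isNClique_insert (hG : TightCircuit G) {X : Finset V}
    (hX : IsCritical G X) {y : V} (hy : y ∉ X) (hc : 2 ≤ #Xᶜ) :
    ¬ G.IsNClique 4 (Insert.insert y X) := by
  intro h
  have h1 := adjCount_singleton_of_isClique G h.isClique (mem_insert_self y X)
  rw [h.card_eq, Finset.insert_eq, adjCount_union_right G (by simpa using hy),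
    adjCount_singleton_self] at h1
  have h2 := hX.insert_eq_univ hG hy (by omega)
  have h3 := card_insert_int hy
  rw [h2, Finset.card_univ] at h3
  have := card_compl_int X
  omega

/-- Sparsity of the complement gives at least three cut edges. With exactly three, the complement is
critical too, and the two vertices covering the cut form a 2-vertex-separation; neither side can be
a K₄ by `IsCritical.not_isNClique_insert`. -/
theorem IsPrimeCircuit.four_le_cut (hG : IsPrimeCircuit G) {X : Finset V} (hX : IsCritical G X)
    (h2 : 2 ≤ #X) (hc : 2 ≤ #Xᶜ) : 4 ≤ adjCount G X Xᶜ := by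
  have hne : Xᶜ.Nonempty := Finset.card_pos.1 (by omega)
  have hXc : Xᶜ ≠ univ := fun h => by
    rw [compl_eq_univ_iff] at h
    simp [h] at h2
  have e1 := hG.tight.sparse _ hne hXc
  have e2 := adjCount_self_compl hG.tight X
  have e3 := card_compl_int X
  have e4 := hX.2
  by_contra! hlt
  have h3 : adjCount G X Xᶜ = 3 := by omega
  have hXc' : IsCritical G Xᶜ := ⟨hne, by omega⟩
  obtain ⟨x, hx, y, hy, hxy⟩ := hG.cut X h3
  have hne : x ≠ y := fun h => hy (h ▸ hx)
  rcases hG.sep (insert y X) (insert x Xᶜ) (by ext; simp) (by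
    have : insert y X ∩ insert x Xᶜ = {x, y} := by
      ext a
      simp only [mem_inter, mem_insert, mem_compl, mem_singleton]
      constructor
      · tauto
      · rintro (rfl | rfl) <;> tauto
    rw [this, Finset.card_pair hne]) (by
    intro a ha b hb hab
    simp only [mem_insert, mem_compl, not_or, not_not] at ha hb
    exact (hxy a ha.2 b hb.2 hab).elim ha.1 hb.1) (by
    obtain ⟨a, ha, hax⟩ := Finset.exists_mem_ne h2 x
    exact ⟨a, by simp [ha, hax]⟩) (by
    obtain ⟨a, ha, hay⟩ := Finset.exists_mem_ne hc y
    exact ⟨a, by simpa [hay] using ha⟩) with h | h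
  · exact hX.not_isNClique_insert hG.tight hy hc h
  · exact hXc'.not_isNClique_insert hG.tight (by simpa using hx) (by simpa using h2) h

/-- The intersection is a critical clique, and k(k - 1) = 4k - 4 holds only for k = 1 and k = 4. -/
theorem IsCritical.subset_or_card_inter (hG : TightCircuit G) {X K : Finset V}
    (hX : IsCritical G X) (hK : G.IsNClique 4 K) (hne : (K ∩ X).Nonempty) (hu : K ∪ X ≠ univ) :
    K ⊆ X ∨ #(K ∩ X) = 1 := by
  have h1 := (hK.isCritical.union_inter hG hX hne hu).2.1.2
  rw [adjCount_self_of_isClique G (hK.isClique.subset (by simp))] at h1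
  have hpos := hne.card_pos
  have hle : #(K ∩ X) ≤ 4 := hK.card_eq ▸ Finset.card_le_card inter_subset_left
  have h2 : ((#(K ∩ X) : ℤ) - 1) * (#(K ∩ X) - 4) = 0 := by linarith
  rcases mul_eq_zero.1 h2 with h | h
  · right; omega
  · left
    have h4 : #(K ∩ X) = 4 := by omega
    have := Finset.eq_of_subset_of_card_le (inter_subset_left (s₁ := K) (s₂ := X))
      (by rw [hK.card_eq, h4])
    exact Finset.inter_eq_left.1 this

/-- A critical set all of whose edges lie in cliques on four vertices inside the set. -/
structure IsCliqueTree (G : SimpleGraph V) (U : Finset V) : Prop where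
  critical : IsCritical G U
  exists_clique : ∃ K ⊆ U, G.IsNClique 4 K
  clique_of_adj : ∀ a ∈ U, ∀ b ∈ U, G.Adj a b → ∃ K ⊆ U, G.IsNClique 4 K ∧ a ∈ K ∧ b ∈ K

omit [Fintype V] [DecidableEq V] in
theorem SimpleGraph.IsNClique.isCliqueTree {K : Finset V} (hK : G.IsNClique 4 K) :
    IsCliqueTree G K :=
  ⟨hK.isCritical, ⟨K, Subset.rfl, hK⟩, fun _ ha _ hb _ => ⟨K, Subset.rfl, hK, ha, hb⟩⟩

omit [Fintype V] [DecidableEq V] in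
theorem IsCliqueTree.four_le_card {U : Finset V} (hU : IsCliqueTree G U) : 4 ≤ #U := by
  obtain ⟨K, hKU, hK⟩ := hU.exists_clique
  exact hK.card_eq ▸ Finset.card_le_card hKU

omit [Fintype V] in
theorem eq_of_adjCount_eq_one {X Y : Finset V} (h : adjCount G X Y = 1) {p q a b : V}
    (hp : p ∈ X) (hq : q ∈ Y) (hpq : G.Adj p q) (ha : a ∈ X) (hb : b ∈ Y) (hab : G.Adj a b) :
    a = p ∧ b = q := by
  have e1 := adjCount_union_left G (X := {p}) (X' := X.erase p) (by simp) Y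
  rw [← Finset.insert_eq, Finset.insert_erase hp] at e1
  have e2 := adjCount_union_right G (X := {q}) (X' := Y.erase q) (by simp) {p}
  rw [← Finset.insert_eq, Finset.insert_erase hq] at e2
  have e3 := adjCount_pos G (mem_singleton_self p) (mem_singleton_self q) hpq
  have e4 := adjCount_nonneg G (X.erase p) Y
  have e5 := adjCount_nonneg G {p} (Y.erase q)
  have hap : a = p := by
    by_contra hn
    exact not_adj_of_adjCount G (by omega) (mem_erase.2 ⟨hn, ha⟩) hb hab
  refine ⟨hap, ?_⟩
  by_contra hn
  exact not_adj_of_adjCount G (X := {p}) (Y := Y.erase q) (by omega) (by simp [hap])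
    (mem_erase.2 ⟨hn, hb⟩) hab

/-- Two common vertices would span an edge lying in a K₄ of U, which could only be K. With one
common vertex c, if K ∪ U were everything there would be exactly one further edge pq, with q in U,
and {c, q} would separate U from K ∪ {q}; the latter has five vertices, so U would be a K₄, which is
excluded by `IsPrimeCircuit.union`. -/
theorem IsCliqueTree.union (hG : IsPrimeCircuit G) {U K : Finset V} (hU : IsCliqueTree G U)
    (hK : G.IsNClique 4 K) (hne : (K ∩ U).Nonempty) (hKU : ¬ K ⊆ U) :
    IsCliqueTree G (K ∪ U) := by
  have hc : #(K ∩ U) = 1 := by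
    by_contra hc
    obtain ⟨p, hp, q, hq, hpq⟩ := Finset.one_lt_card.1
      (show 1 < #(K ∩ U) by have := hne.card_pos; omega)
    rw [mem_inter] at hp hq
    obtain ⟨L, hLU, hL, hpL, hqL⟩ :=
      hU.clique_of_adj p hp.2 q hq.2 (hK.isClique hp.1 hq.1 hpq)
    have hlt : 1 < #(K ∩ L) := Finset.one_lt_card.2
      ⟨p, mem_inter.2 ⟨hp.1, hpL⟩, q, mem_inter.2 ⟨hq.1, hqL⟩, hpq⟩
    have hKL : K = L := by
      by_contra hn
      have := hG.inter K L hK hL hn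
      omega
    exact hKU (hKL ▸ hLU)
  have hu : K ∪ U ≠ univ := by
    intro hu
    have e1 := adjCount_union_inter G K U
    have e2 := card_union_add_card_inter_int K U
    obtain ⟨c, hcK⟩ := Finset.card_eq_one.1 hc
    have e3 := hK.isCritical.2
    have e4 := hU.critical.2
    rw [hc, hu, Finset.card_univ, hK.card_eq] at e2
    rw [hcK, adjCount_singleton_self, hu, hG.tight.total] at e1
    rw [hK.card_eq] at e3
    have e5 : adjCount G (K \ U) (U \ K) = 1 := by omega
    obtain ⟨p, hp, q, hq, hpq⟩ := exists_adj_of_adjCount G e5.ge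
    have hp' := mem_sdiff.1 hp
    have hq' := mem_sdiff.1 hq
    have hcc : c ∈ K ∧ c ∈ U := mem_inter.1 (by rw [hcK]; simp)
    have hmem : ∀ a, a ∈ K ∨ a ∈ U := fun a => mem_union.1 (hu ▸ mem_univ a)
    have hcq : c ≠ q := fun h => hq'.2 (h ▸ hcc.1)
    rcases hG.sep U (insert q K) (by
      ext a; have := hmem a; simp; tauto) (by
      have : U ∩ insert q K = {c, q} := by
        ext a
        have := Finset.ext_iff.1 hcK a
        simp only [mem_inter, mem_insert, mem_singleton] at this ⊢
        constructor
        · tauto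
        · rintro (rfl | rfl) <;> tauto
      rw [this, Finset.card_pair hcq]) (by
      intro a ha b hb hab
      simp only [mem_insert, not_or] at ha
      exact ha.1 (eq_of_adjCount_eq_one e5 hp hq hpq
        (mem_sdiff.2 ⟨(hmem b).resolve_right hb, hb⟩)
        (mem_sdiff.2 ⟨(hmem a).resolve_left ha.2, ha.2⟩) hab.symm).2) (by
      have h3 := Finset.le_card_sdiff {c, q} U
      have h4 := hU.four_le_card
      rw [Finset.card_pair hcq] at h3
      obtain ⟨a, ha⟩ := Finset.card_pos.1 (show 0 < #(U \ {c, q}) by omega)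
      refine ⟨a, fun h => ?_⟩
      have := Finset.ext_iff.1 hcK a
      simp only [mem_inter, mem_insert, mem_singleton, mem_sdiff] at this ha h
      tauto) ⟨p, hp'.2⟩ with h | h
    · exact hG.union K U hK h hc hu
    · have h5 := h.card_eq
      rw [Finset.card_insert_of_notMem hq'.2, hK.card_eq] at h5
      omega
  obtain ⟨h1, -, h3⟩ := hK.isCritical.union_inter hG.tight hU.critical hne hu
  refine ⟨h1, ⟨K, subset_union_left, hK⟩, fun a ha b hb hab => ?_⟩
  have key : (a ∈ K ∧ b ∈ K) ∨ (a ∈ U ∧ b ∈ U) := by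
    have n1 := fun ha hb => not_adj_of_adjCount G h3.le (x := a) (y := b) ha hb hab
    have n2 := fun ha hb => not_adj_of_adjCount G h3.le (x := b) (y := a) ha hb hab.symm
    simp only [mem_sdiff, mem_union] at n1 n2 ha hb
    tauto
  rcases key with h | h
  · exact ⟨K, subset_union_left, hK, h⟩
  · obtain ⟨L, hL, h'⟩ := hU.clique_of_adj a h.1 b h.2 hab
    exact ⟨L, hL.trans subset_union_right, h'⟩

theorem clique_subset_of_maximal (hG : IsPrimeCircuit G) {U K : Finset V}
    (hU : Maximal (IsCliqueTree G) U) (hK : G.IsNClique 4 K) (hne : (K ∩ U).Nonempty) :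
    K ⊆ U := by
  by_contra h
  exact h (subset_union_left.trans (hU.2 (hU.1.union hG hK hne h) subset_union_right))

omit [DecidableEq V] in
theorem exists_maximal_cliqueTree {K : Finset V} (hK : G.IsNClique 4 K) :
    ∃ U, K ⊆ U ∧ Maximal (IsCliqueTree G) U :=
  (Set.toFinite {U | IsCliqueTree G U}).exists_le_maximal hK.isCliqueTree

/-- Otherwise, by connectedness, an edge of U' leaves U ∩ U'. The K₄ of U' on this edge meets U, so
by maximality U absorbs it. -/
theorem eq_of_maximal_cliqueTree (hG : IsPrimeCircuit G) {U U' : Finset V}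
    (hU : Maximal (IsCliqueTree G) U) (hU' : Maximal (IsCliqueTree G) U')
    (hne : (U ∩ U').Nonempty) : U = U' := by
  have hsub : U' ⊆ U := by
    by_contra hn
    obtain ⟨a, ha, b, hb, hab⟩ := hU'.1.critical.exists_adj hG.tight (D := U ∩ U')
      ⟨inter_subset_right, fun h => hn (h.trans inter_subset_left)⟩ hne
    rw [mem_inter] at ha
    simp only [mem_sdiff, mem_inter, not_and] at hb
    obtain ⟨K, -, hK, haK, hbK⟩ := hU'.1.clique_of_adj a ha.2 b hb.1 hab
    exact hb.2 (clique_subset_of_maximal hG hU hK ⟨a, mem_inter.2 ⟨haK, ha.1⟩⟩ hbK) hb.1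
  exact (hU'.2 hU.1 hsub).antisymm hsub

/-- A clique tree arises from any smaller critical set inside it by enlarging that set and then
attaching one clique at one vertex. -/
theorem IsCliqueTree.exists_leaf (hG : TightCircuit G) {U D : Finset V} (hU : IsCliqueTree G U)
    (hD : IsCritical G D) (hDU : D ⊂ U) :
    ∃ D' K c, D ⊆ D' ∧ G.IsNClique 4 K ∧ K ∩ D' = {c} ∧ K ∪ D' = U ∧
      ∀ a ∈ K, a ∉ D' → ∀ b ∈ D', b ∉ K → ¬ G.Adj a b := by
  -- An edge of U leaving a maximal critical proper subset D' lies in a K₄ inside U; adding this K₄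
  -- keeps the set critical, so it must complete U.
  obtain ⟨D', hDD', hmax⟩ :=
    (Set.toFinite {D' | IsCritical G D' ∧ D' ⊂ U}).exists_le_maximal ⟨hD, hDU⟩
  obtain ⟨hcrit, hss⟩ := hmax.1
  obtain ⟨a, ha, b, hb, hab⟩ := hU.critical.exists_adj hG hss hcrit.1
  rw [mem_sdiff] at hb
  obtain ⟨K, hKU, hK, haK, hbK⟩ := hU.clique_of_adj a (hss.1 ha) b hb.1 hab
  have hle : K ∪ D' ⊆ U := union_subset hKU hss.1
  have hne : K ∪ D' ≠ univ := fun h => hU.critical.ne_univ hG (univ_subset_iff.1 (h ▸ hle))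
  have hKD : (K ∩ D').Nonempty := ⟨a, mem_inter.2 ⟨haK, ha⟩⟩
  obtain ⟨h1, -, h3⟩ := hK.isCritical.union_inter hG hcrit hKD hne
  obtain ⟨c, hc⟩ := Finset.card_eq_one.1
    ((hcrit.subset_or_card_inter hG hK hKD hne).resolve_left fun h => hb.2 (h hbK))
  refine ⟨D', K, c, hDD', hK, hc, ?_, fun a haK haD b hbD hbK =>
    not_adj_of_adjCount G h3.le (mem_sdiff.2 ⟨haK, haD⟩) (mem_sdiff.2 ⟨hbD, hbK⟩)⟩
  by_contra hn
  have := hmax.2 (y := K ∪ D') ⟨h1, hle, fun h => hn (hle.antisymm h)⟩ subset_union_right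
  exact hb.2 (this (mem_union_left _ hbK))

/-- If the attachment at `c` and `r` of a clique `K` separates it from the rest, then the rest
is a clique containing `r`. -/
theorem IsPrimeCircuit.isNClique_of_attached (hG : IsPrimeCircuit G) {K R : Finset V} {c r : V}
    (hK : G.IsNClique 4 K) (hi : K ∩ R = {c}) (hrK : r ∉ K) (hr : r ∈ R)
    (hu : K ∪ R = univ) (hadj : ∀ a ∈ K, a ∉ R → ∀ b ∈ R, b ∉ K → G.Adj a b → b = r)
    (hne : ∃ b ∈ R, b ∉ K ∧ b ≠ r) : G.IsNClique 4 R := by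
  have hmem : ∀ a, a ∈ K ∨ a ∈ R := fun a => mem_union.1 (hu ▸ mem_univ a)
  have hc : c ∈ K ∧ c ∈ R := mem_inter.1 (by rw [hi]; simp)
  have hcr : c ≠ r := fun h => hrK (h ▸ hc.1)
  -- The pair {c, r} separates K ∪ {r} from R, and K ∪ {r} has five vertices.
  refine (hG.sep (insert r K) R (by ext a; have := hmem a; simp; tauto) ?_ ?_ ?_ ?_).resolve_left
    fun h => ?_
  · have : insert r K ∩ R = {c, r} := by
      ext a
      have := Finset.ext_iff.1 hi a
      simp only [mem_inter, mem_insert, mem_singleton] at this ⊢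
      constructor
      · tauto
      · rintro (rfl | rfl) <;> tauto
    rw [this, Finset.card_pair hcr]
  · intro a ha b hb hab
    rw [mem_insert, not_or] at hb
    exact hb.1 (hadj a ((hmem a).resolve_right ha) ha b ((hmem b).resolve_left hb.2) hb.2 hab)
  · obtain ⟨a, ha, hac⟩ := Finset.exists_mem_ne (s := K) (by rw [hK.card_eq]; norm_num) c
    refine ⟨a, fun h => hac ?_⟩
    simpa [hi] using mem_inter.2 ⟨ha, h⟩
  · obtain ⟨b, -, hbK, hbr⟩ := hne
    exact ⟨b, by simp [hbK, hbr]⟩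
  · have h5 := h.card_eq
    rw [Finset.card_insert_of_notMem hrK, hK.card_eq] at h5
    omega

/-- If r were the only vertex outside, it would lie in a K₄ meeting U: with three of its neighbours
when U is itself a K₄, and otherwise because {c, r} cuts off a leaf K₄ of U. Maximality of U forbids
this. -/
theorem two_le_card_compl (hG : IsPrimeCircuit G) {U : Finset V}
    (hU : Maximal (IsCliqueTree G) U) : 2 ≤ #Uᶜ := by
  by_contra! hlt
  have h0 : Uᶜ.Nonempty := by
    rw [nonempty_iff_ne_empty, Ne, compl_eq_empty_iff]
    exact hU.1.critical.ne_univ hG.tight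
  have hpos := h0.card_pos
  obtain ⟨r, hr⟩ := Finset.card_eq_one.1 (show #Uᶜ = 1 by omega)
  have hmem : ∀ a, a ∉ U ↔ a = r := fun a => by
    have := Finset.ext_iff.1 hr a
    simpa using this
  have hrU := (hmem r).2 rfl
  have hnoclique : ∀ L, G.IsNClique 4 L → r ∉ L := by
    intro L hL hrL
    obtain ⟨b, hb, hbr⟩ := Finset.exists_mem_ne (s := L) (by rw [hL.card_eq]; norm_num) r
    have hbU : b ∈ U := by
      by_contra h
      exact hbr ((hmem b).1 h)
    exact hrU (clique_subset_of_maximal hG hU hL ⟨b, mem_inter.2 ⟨hb, hbU⟩⟩ hrL)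
  obtain ⟨K₀, hK₀U, hK₀⟩ := hU.1.exists_clique
  by_cases hKU : K₀ = U
  · classical
    have hdeg := hG.tight.three_le_degree r
    rw [adjCount_singleton] at hdeg
    obtain ⟨T, hT, hT3⟩ := Finset.exists_subset_card_eq
      (show 3 ≤ #{y ∈ univ | G.Adj r y} by exact_mod_cast hdeg)
    have hTr : ∀ a ∈ T, G.Adj r a := fun a ha => (mem_filter.1 (hT ha)).2
    have hTU : T ⊆ U := fun a ha => by
      by_contra h
      exact (hTr a ha).ne ((hmem a).1 h).symm
    refine hnoclique (insert r T) ⟨?_, ?_⟩ (mem_insert_self _ _)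
    · rw [Finset.coe_insert]
      refine SimpleGraph.IsClique.insert (hK₀.isClique.subset ?_) fun b hb _ => hTr b hb
      rw [hKU]
      exact_mod_cast hTU
    · rw [Finset.card_insert_of_notMem fun h => hrU (hTU h), hT3]
  · obtain ⟨D', K, c, hD, hK, hi, hu, hadj⟩ := hU.1.exists_leaf hG.tight hK₀.isCritical
      (Finset.ssubset_iff_subset_ne.2 ⟨hK₀U, hKU⟩)
    have hrK : r ∉ K := fun h => hrU (hu ▸ mem_union_left _ h)
    have hcl := hG.isNClique_of_attached (R := insert r D') (r := r) hK
      (by rw [Finset.inter_insert_of_notMem hrK, hi]) hrK (mem_insert_self _ _)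
      (by
        ext a
        have := hmem a
        have h2 := Finset.ext_iff.1 hu a
        simp only [mem_union, mem_insert, mem_univ, iff_true] at h2 ⊢
        tauto)
      (by
        intro a ha haR b hb hbK hab
        rw [mem_insert, not_or] at haR
        rw [mem_insert] at hb
        by_contra hn
        exact hadj a ha haR.2 b (hb.resolve_left hn) hbK hab)
      (by
        obtain ⟨b, hb, hbc⟩ := Finset.exists_mem_ne (s := K₀) (by rw [hK₀.card_eq]; norm_num) c
        refine ⟨b, mem_insert_of_mem (hD hb), fun h => hbc ?_, fun h => hrU (h ▸ hK₀U hb)⟩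
        simpa [hi] using mem_inter.2 ⟨h, hD hb⟩)
    exact hnoclique _ hcl (mem_insert_self _ _)

theorem deficiency_nonpos (hG : IsPrimeCircuit G) {U : Finset V}
    (hU : Maximal (IsCliqueTree G) U) : deficiency G U ≤ 0 := by
  have := hG.four_le_cut hU.1.critical (by have := hU.1.four_le_card; omega)
    (two_le_card_compl hG hU)
  rw [hU.1.critical.deficiency]
  omega

/-- If `Y` splits no maximal clique tree, then its deficiency is at most the number of nodes
in `Y` that lie in no clique on four vertices. -/
theorem deficiency_le (hG : IsPrimeCircuit G) {Y P : Finset V}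
    (hY : ∀ U, Maximal (IsCliqueTree G) U → (U ∩ Y).Nonempty → U ⊆ Y)
    (hP : ∀ v ∈ Y, IsNode G v → (∀ K, G.IsNClique 4 K → v ∉ K) → v ∈ P) :
    deficiency G Y ≤ #P := by
  classical
  let F : Finset (Finset V) := {U | Maximal (IsCliqueTree G) U ∧ U ⊆ Y}
  have hF : ∀ U ∈ F, Maximal (IsCliqueTree G) U ∧ U ⊆ Y := fun U h => (mem_filter.1 h).2
  have hsub : F.biUnion id ⊆ Y := by
    rw [biUnion_subset]
    exact fun U h => (hF U h).2
  -- The maximal clique trees inside Y are disjoint, so their nonpositive deficiencies add up.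
  have h1 : deficiency G (F.biUnion id) ≤ 0 := by
    rw [deficiency, Finset.sum_biUnion]
    · exact Finset.sum_nonpos fun U h => deficiency_nonpos hG (hF U h).1
    · intro U h U' h' hne
      change Disjoint U U'
      by_contra hd
      rw [not_disjoint_iff_nonempty_inter] at hd
      exact hne (eq_of_maximal_cliqueTree hG (hF U h).1 (hF U' h').1 hd)
  -- Each remaining vertex contributes at most 1, and a positive amount only if it is a node outside
  -- all K₄'s.
  have h2 : deficiency G (Y \ F.biUnion id) ≤ #P := by
    calc deficiency G (Y \ F.biUnion id)
        ≤ ∑ v ∈ Y \ F.biUnion id, if v ∈ P then (1 : ℤ) else 0 := by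
          refine Finset.sum_le_sum fun v hv => ?_
          rw [mem_sdiff] at hv
          have h3 := hG.tight.three_le_degree v
          split_ifs with hvP
          · omega
          · by_contra hlt
            refine hvP (hP v hv.1 (isNode_iff.2 (by omega)) fun K hK hvK => hv.2 ?_)
            obtain ⟨U, hKU, hU⟩ := exists_maximal_cliqueTree hK
            have hUY := hY U hU ⟨v, mem_inter.2 ⟨hKU hvK, hv.1⟩⟩
            exact mem_biUnion.2 ⟨U, mem_filter.2 ⟨mem_univ _, hU, hUY⟩, hKU hvK⟩
      _ ≤ #P := by
          rw [Finset.sum_boole]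
          exact_mod_cast Finset.card_le_card fun v hv => (mem_filter.1 hv).2
  have h3 : deficiency G (Y \ F.biUnion id) + deficiency G (F.biUnion id) = deficiency G Y :=
    Finset.sum_sdiff hsub
  omega

end Good

/-! ### Flaps and non-admissible nodes. -/

section Flaps

open Finset

variable {V : Type*} [Fintype V] [DecidableEq V] {G : SimpleGraph V}

/-- `W` is a flap of `v` at `x`: its complement is critical and contains `v`, and `x` is the only
neighbour of `v` in `W`. -/
structure IsFlap (G : SimpleGraph V) (v x : V) (W : Finset V) : Prop where
  mem : x ∈ W
  notMem : v ∉ W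
  adj : G.Adj v x
  critical : IsCritical G Wᶜ
  eq_of_adj : ∀ y ∈ W, G.Adj v y → y = x

/-- A node with a flap at each neighbour. -/
def IsFlapNode (G : SimpleGraph V) (v : V) : Prop :=
  IsNode G v ∧ ∀ x, G.Adj v x → ∃ W, IsFlap G v x W

omit [Fintype V] in
theorem adjCount_singleton_eq_ite {v x y z : V} (hxy : x ≠ y) (hxz : x ≠ z) (hyz : y ≠ z)
    (hN : ∀ w, G.Adj v w ↔ w = x ∨ w = y ∨ w = z) (X : Finset V) :
    adjCount G {v} X = (if x ∈ X then 1 else 0) + (if y ∈ X then 1 else 0) +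
      (if z ∈ X then 1 else 0) := by
  classical
  rw [adjCount_singleton]
  have : ({w ∈ X | G.Adj v w} : Finset V) = {w ∈ ({x, y, z} : Finset V) | w ∈ X} := by
    ext w
    simp [hN, and_comm]
  rw [this, Finset.card_filter]
  push_cast
  rw [Finset.sum_insert (by simp [hxy, hxz]), Finset.sum_insert (by simpa using hyz),
    Finset.sum_singleton]
  ring

omit [Fintype V] [DecidableEq V] in
theorem IsNode.exists_others {v x : V} (hv : IsNode G v) (hx : G.Adj v x) :
    ∃ y z, x ≠ y ∧ x ≠ z ∧ y ≠ z ∧ ∀ w, G.Adj v w ↔ w = x ∨ w = y ∨ w = z := by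
  obtain ⟨a, b, c, hab, hac, hbc, hN⟩ := hv.exists_neighbors
  rcases (hN x).1 hx with rfl | rfl | rfl
  · exact ⟨b, c, hab, hac, hbc, hN⟩
  · exact ⟨a, c, hab.symm, hbc, hac, fun w => by rw [hN]; tauto⟩
  · exact ⟨a, b, hac.symm, hbc.symm, hab, fun w => by rw [hN]; tauto⟩

/-- The other two neighbours of v lie outside W, and removing a vertex with exactly two neighbours
in the rest preserves criticality. -/
theorem IsFlap.erase {v x : V} {W : Finset V} (hv : IsNode G v) (hW : IsFlap G v x W) :
    IsCritical G (Wᶜ.erase v) := by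
  obtain ⟨y, z, hxy, hxz, hyz, hN⟩ := hv.exists_others hW.adj
  have hy : y ∉ W := fun h => hxy (hW.eq_of_adj y h ((hN y).2 (by simp))).symm
  have hz : z ∉ W := fun h => hxz (hW.eq_of_adj z h ((hN z).2 (by simp))).symm
  have hyv : y ≠ v := ((hN y).2 (by simp)).ne'
  have hzv : z ≠ v := ((hN z).2 (by simp)).ne'
  refine IsCritical.of_insert (Finset.notMem_erase v _) ?_ ⟨y, by simp [hy, hyv]⟩ ?_
  · rw [Finset.insert_erase (by simpa using hW.notMem)]
    exact hW.critical
  · rw [adjCount_singleton_eq_ite hxy hxz hyz hN]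
    simp [hy, hz, hyv, hzv, hW.mem]

/-- A critical set blocking the pair y, z stays critical when v is added, and its complement is then
a flap at the third neighbour. -/
theorem IsFlap.of_critical {v x y z : V} (hxy : x ≠ y) (hxz : x ≠ z) (hyz : y ≠ z)
    (hN : ∀ w, G.Adj v w ↔ w = x ∨ w = y ∨ w = z) {X : Finset V} (hX : IsCritical G X)
    (hv : v ∉ X) (hx : x ∉ X) (hy : y ∈ X) (hz : z ∈ X) : IsFlap G v x (insert v X)ᶜ := by
  have hvx := (hN x).2 (by simp)
  refine ⟨by simp [hvx.ne', hx], by simp, hvx, ?_, fun w hw hvw => ?_⟩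
  · rw [compl_compl]
    refine hX.insert hv ?_
    rw [adjCount_singleton_eq_ite hxy hxz hyz hN]
    simp [hx, hy, hz]
  · rcases (hN w).1 hvw with rfl | rfl | rfl
    · rfl
    · simp [hy] at hw
    · simp [hz] at hw

/-- Flaps of a node at different neighbours are disjoint, and those neighbours are not adjacent. -/
theorem IsFlap.disjoint (hG : TightCircuit G) {v x y : V} {W W' : Finset V} (hv : IsNode G v)
    (hW : IsFlap G v x W) (hW' : IsFlap G v y W') (hxy : x ≠ y) :
    Disjoint W W' ∧ ¬ G.Adj x y := by
  obtain ⟨a, b, hxa, hxb, hab, hN⟩ := hv.exists_others hW.adj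
  obtain ⟨z, hxz, hyz, hN⟩ : ∃ z, x ≠ z ∧ y ≠ z ∧ ∀ w, G.Adj v w ↔ w = x ∨ w = y ∨ w = z := by
    rcases (hN y).1 hW'.adj with rfl | rfl | rfl
    · exact absurd rfl hxy
    · exact ⟨b, hxb, hab, hN⟩
    · exact ⟨a, hxa, hab.symm, fun w => by rw [hN]; tauto⟩
  have hvx := hW.adj.ne'
  have hvy := hW'.adj.ne'
  have hvz : z ≠ v := ((hN z).2 (by simp)).ne'
  have hx' : x ∉ W' := fun h => hxy (hW'.eq_of_adj x h hW.adj)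
  have hy' : y ∉ W := fun h => hxy (hW.eq_of_adj y h hW'.adj).symm
  have hz : z ∉ W := fun h => hxz (hW.eq_of_adj z h ((hN z).2 (by simp))).symm
  have hz' : z ∉ W' := fun h => hyz (hW'.eq_of_adj z h ((hN z).2 (by simp))).symm
  have hvu : v ∉ Wᶜ.erase v ∪ W'ᶜ.erase v := by simp
  -- Both critical sets contain the third neighbour z and avoid v. Their union has all three
  -- neighbours of v, so with v it is everything, whence W and W' are disjoint; and no edge joins
  -- their differences, which contain y and x.
  obtain ⟨h1, -, h3⟩ := (hW.erase hv).union_inter hG (hW'.erase hv)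
    ⟨z, by simp [hz, hz', hvz]⟩ fun h => hvu (h ▸ mem_univ v)
  constructor
  · have hu := h1.insert_eq_univ hG hvu (by
      rw [adjCount_singleton_eq_ite hxy hxz hyz hN]
      simp [hx', hy', hz, hvx, hvy, hvz])
    rw [Finset.disjoint_left]
    intro w hw hw'
    have := Finset.ext_iff.1 hu w
    have hwv : w ≠ v := fun h => hW.notMem (h ▸ hw)
    simp [hw, hw', hwv] at this
  · exact fun h => not_adj_of_adjCount G h3.le (x := y) (y := x)
      (by simp [hy', hvy, hW'.mem]) (by simp [hx', hvx, hW.mem]) h.symm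

theorem IsFlapNode.not_adj (hG : TightCircuit G) {v x y : V} (hv : IsFlapNode G v)
    (hx : G.Adj v x) (hy : G.Adj v y) : ¬ G.Adj x y := by
  intro h
  obtain ⟨W, hW⟩ := hv.2 x hx
  obtain ⟨W', hW'⟩ := hv.2 y hy
  exact (hW.disjoint hG hv.1 hW' h.ne).2 h

theorem IsFlapNode.notMem_clique (hG : TightCircuit G) {v : V} (hv : IsFlapNode G v)
    {K : Finset V} (hK : G.IsNClique 4 K) : v ∉ K := by
  intro hvK
  have h3 : #(K.erase v) = 3 := by rw [Finset.card_erase_of_mem hvK, hK.card_eq]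
  obtain ⟨x, hx, y, hy, hxy⟩ := Finset.one_lt_card.1 (show 1 < #(K.erase v) by omega)
  rw [mem_erase] at hx hy
  exact hv.not_adj hG (hK.isClique hvK hx.2 hx.1.symm) (hK.isClique hvK hy.2 hy.1.symm)
    (hK.isClique hx.2 hy.2 hxy)

/-- The neighbours of a node in a clique on four vertices lie in the clique. -/
theorem IsNode.mem_clique {a u : V} (ha : IsNode G a) {K : Finset V} (hK : G.IsNClique 4 K)
    (haK : a ∈ K) (hau : G.Adj a u) : u ∈ K := by
  by_contra hu
  have h1 := adjCount_singleton_of_isClique G hK.isClique haK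
  rw [hK.card_eq] at h1
  have h2 := adjCount_compl G {a} K
  rw [h1, isNode_iff.1 ha] at h2
  exact not_adj_of_adjCount G (Y := Kᶜ) (by omega) (mem_singleton_self a) (by simpa using hu) hau

/-- A critical set that prevents the reduction cannot contain z as well: with three neighbours of v
in it, adding v would give all of V. -/
theorem exists_blocking (hG : TightCircuit G) {v x y z : V} (hadm : ¬ IsAdmissibleNode G v)
    (hxy : x ≠ y) (hxz : x ≠ z) (hyz : y ≠ z)
    (hN : ∀ w, G.Adj v w ↔ w = x ∨ w = y ∨ w = z) (hn : ¬ G.Adj x y) :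
    ∃ X, IsCritical G X ∧ v ∉ X ∧ x ∈ X ∧ y ∈ X ∧ z ∉ X := by
  by_contra! hcon
  refine hadm (isAdmissibleNode_of hG hxy hxz hyz hN hn fun X hv hx hy hX => ?_)
  refine hX.insert_eq_univ hG hv ?_
  rw [adjCount_singleton_eq_ite hxy hxz hyz hN]
  simp [hx, hy, hcon X hX hv hx hy]

/-- The sets blocking xz and yz share z and avoid v, so no edge joins their differences; but xy
does. -/
theorem not_one_adj (hG : TightCircuit G) {v x y z : V} (hadm : ¬ IsAdmissibleNode G v)
    (hxy : x ≠ y) (hxz : x ≠ z) (hyz : y ≠ z)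
    (hN : ∀ w, G.Adj v w ↔ w = x ∨ w = y ∨ w = z) (h1 : G.Adj x y) (h2 : ¬ G.Adj x z)
    (h3 : ¬ G.Adj y z) : False := by
  obtain ⟨X, hX, hvX, hxX, hzX, hyX⟩ :=
    exists_blocking hG hadm hxz hxy hyz.symm (fun w => by rw [hN]; tauto) h2
  obtain ⟨Y, hY, hvY, hyY, hzY, hxY⟩ :=
    exists_blocking hG hadm hyz hxy.symm hxz.symm (fun w => by rw [hN]; tauto) h3
  have hv : v ∉ X ∪ Y := by simp [hvX, hvY]
  obtain ⟨-, -, h⟩ := hX.union_inter hG hY ⟨z, mem_inter.2 ⟨hzX, hzY⟩⟩ fun h =>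
    hv (h ▸ mem_univ v)
  exact not_adj_of_adjCount G h.le (mem_sdiff.2 ⟨hxX, hxY⟩) (mem_sdiff.2 ⟨hyY, hyX⟩) h1

/-- Let X block xz. Then y has exactly the neighbours x and z in X, and X together with y and v is
V. So {x, z} separates {v, y} from the rest, and neither side is a K₄ because x and z are not
adjacent. -/
theorem not_two_adj (hG : IsPrimeCircuit G) {v x y z : V} (hadm : ¬ IsAdmissibleNode G v)
    (hxy : x ≠ y) (hxz : x ≠ z) (hyz : y ≠ z)
    (hN : ∀ w, G.Adj v w ↔ w = x ∨ w = y ∨ w = z) (h1 : G.Adj x y) (h2 : ¬ G.Adj x z)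
    (h3 : G.Adj y z) : False := by
  obtain ⟨X, hX, hvX, hxX, hzX, hyX⟩ :=
    exists_blocking hG.tight hadm hxz hxy hyz.symm (fun w => by rw [hN]; tauto) h2
  have hvy : v ≠ y := ((hN y).2 (by simp)).ne
  have hvx : v ≠ x := ((hN x).2 (by simp)).ne
  have hvz : v ≠ z := ((hN z).2 (by simp)).ne
  have hv' : v ∉ insert y X := by simp [hvy, hvX]
  have e1 : adjCount G {y} X = 2 := by
    have ge : (2 : ℤ) ≤ adjCount G {y} X := by
      have h4 := adjCount_mono G (Subset.refl {y})
        (show ({x, z} : Finset V) ⊆ X by intro w; simp; rintro (rfl | rfl) <;> assumption)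
      rw [adjCount_singleton_eq_card G (T := {x, z})
        (by simp [h1.symm, h3]) Subset.rfl, Finset.card_pair hxz] at h4
      exact_mod_cast h4
    by_contra hne
    exact hv' (hX.insert_eq_univ hG.tight hyX (by omega) ▸ mem_univ v)
  have hyadj : ∀ a ∈ X, G.Adj y a → a = x ∨ a = z := by
    intro a ha hya
    by_contra! hn
    have h4 := adjCount_mono G (Subset.refl {y})
      (show ({x, z, a} : Finset V) ⊆ X by intro w; simp; rintro (rfl | rfl | rfl) <;> assumption)
    rw [adjCount_singleton_eq_card G (T := {x, z, a}) (by simp [h1.symm, h3, hya]) Subset.rfl,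
      Finset.card_eq_three.2 ⟨x, z, a, hxz, hn.1.symm, hn.2.symm, rfl⟩, e1] at h4
    norm_num at h4
  have hu := (hX.insert hyX e1).insert_eq_univ hG.tight hv' (by
    rw [adjCount_singleton_eq_ite hxy hxz hyz hN]
    simp [hxX, hzX])
  have hmem : ∀ w, w = v ∨ w = y ∨ w ∈ X := fun w => by
    simpa using Finset.ext_iff.1 hu w
  rcases hG.sep X {v, y, x, z} (by ext w; have := hmem w; simp; tauto) (by
    have : X ∩ {v, y, x, z} = {x, z} := by
      ext w
      simp only [mem_inter, mem_insert, mem_singleton]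
      constructor
      · rintro ⟨hw, rfl | rfl | h | h⟩
        · exact absurd hw hvX
        · exact absurd hw hyX
        · exact Or.inl h
        · exact Or.inr h
      · rintro (rfl | rfl) <;> simp [hxX, hzX]
    rw [this, Finset.card_pair hxz]) (by
    intro a ha b hb hab
    simp only [mem_insert, mem_singleton, not_or] at ha
    have haX := ((hmem a).resolve_left ha.1).resolve_left ha.2.1
    rcases hmem b with rfl | rfl | h
    · have := (hN a).1 hab.symm
      tauto
    · have := hyadj a haX hab.symm
      tauto
    · exact hb h) (by
    obtain ⟨p, hp, b, hb, hpb⟩ := hX.exists_adj hG.tight (D := {x})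
      ⟨by simpa using hxX, fun h => hxz (mem_singleton.1 (h hzX)).symm⟩ (singleton_nonempty x)
    rw [mem_singleton] at hp
    subst hp
    rw [mem_sdiff, mem_singleton] at hb
    refine ⟨b, ?_⟩
    simp only [mem_insert, mem_singleton, not_or]
    refine ⟨fun h => hvX (h ▸ hb.1), fun h => hyX (h ▸ hb.1), hb.2, fun h => h2 (h ▸ hpb)⟩)
    ⟨v, hvX⟩ with h | h
  · exact h2 (h.isClique hxX hzX hxz)
  · exact h2 (h.isClique (by simp) (by simp) hxz)

/-- A node that is not admissible lies in a clique on four vertices or has a flap at each of its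
neighbours. -/
theorem mem_clique_or_isFlapNode (hG : IsPrimeCircuit G) {v : V} (hv : IsNode G v)
    (hadm : ¬ IsAdmissibleNode G v) :
    (∃ K, G.IsNClique 4 K ∧ v ∈ K) ∨ IsFlapNode G v := by
  obtain ⟨x, y, z, hxy, hxz, hyz, hN⟩ := hv.exists_neighbors
  have hN1 : ∀ w, G.Adj v w ↔ w = x ∨ w = z ∨ w = y := fun w => by rw [hN]; tauto
  have hN2 : ∀ w, G.Adj v w ↔ w = y ∨ w = x ∨ w = z := fun w => by rw [hN]; tauto
  have hN3 : ∀ w, G.Adj v w ↔ w = y ∨ w = z ∨ w = x := fun w => by rw [hN]; tauto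
  have hN4 : ∀ w, G.Adj v w ↔ w = z ∨ w = x ∨ w = y := fun w => by rw [hN]; tauto
  have hvx := (hN x).2 (by simp)
  have hvy := (hN y).2 (by simp)
  have hvz := (hN z).2 (by simp)
  have s1 := G.adj_comm x y
  have s2 := G.adj_comm x z
  have s3 := G.adj_comm y z
  by_cases a1 : G.Adj x y <;> by_cases a2 : G.Adj x z <;> by_cases a3 : G.Adj y z
  · refine Or.inl ⟨{v, x, y, z}, ?_, by simp⟩
    refine (SimpleGraph.is3Clique_triple_iff.2 ⟨a1, a2, a3⟩).insert fun w hw => ?_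
    exact (hN w).2 (by simpa using hw)
  · exact (not_two_adj hG hadm hxy.symm hyz hxz hN2 (s1.1 a1) a3 a2).elim
  · exact (not_two_adj hG hadm hxy hxz hyz hN a1 a2 a3).elim
  · exact (not_one_adj hG.tight hadm hxy hxz hyz hN a1 a2 a3).elim
  · exact (not_two_adj hG hadm hxz hxy hyz.symm hN1 a2 a1 (s3.1 a3)).elim
  · exact (not_one_adj hG.tight hadm hxz hxy hyz.symm hN1 a2 a1 (fun h => a3 (s3.2 h))).elim
  · exact (not_one_adj hG.tight hadm hyz hxy.symm hxz.symm hN3 a3 (fun h => a1 (s1.2 h))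
      (fun h => a2 (s2.2 h))).elim
  · refine Or.inr ⟨hv, fun w hw => ?_⟩
    rcases (hN w).1 hw with rfl | rfl | rfl
    · obtain ⟨X, hX, hvX, h1, h2, h3⟩ :=
        exists_blocking hG.tight hadm hyz hxy.symm hxz.symm hN3 a3
      exact ⟨_, IsFlap.of_critical hxy hxz hyz hN hX hvX h3 h1 h2⟩
    · obtain ⟨X, hX, hvX, h1, h2, h3⟩ :=
        exists_blocking hG.tight hadm hxz hxy hyz.symm hN1 a2
      exact ⟨_, IsFlap.of_critical hxy.symm hyz hxz hN2 hX hvX h3 h1 h2⟩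
    · obtain ⟨X, hX, hvX, h1, h2, h3⟩ :=
        exists_blocking hG.tight hadm hxy hxz hyz hN a1
      exact ⟨_, IsFlap.of_critical hxz.symm hyz.symm hxy hN4 hX hvX h3 h1 h2⟩

/-- A set of nodes cannot have minimum degree two in the graph induced by it and one more node. -/
theorem TightCircuit.not_two_le_degree (hG : TightCircuit G) {S P : Finset V}
    (hS : ∀ v ∈ S, IsNode G v) (hP : ∀ v ∈ P, IsNode G v) (hne : S.Nonempty)
    (hd : Disjoint S P) (hc : #P ≤ 1) : ∃ u ∈ S, adjCount G {u} (S ∪ P) ≤ 1 := by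
  by_contra! hcon
  -- Degree at least two throughout S, with at most |S| - 1 edges inside S, forces two edges from S
  -- to P; then S ∪ P has too many edges for a forest.
  have h1 := hG.forest hS hne
  have h2 := hG.forest (S := S ∪ P) (fun v hv => (mem_union.1 hv).elim (hS v) (hP v))
    (hne.mono subset_union_left)
  rw [adjCount_union_self G hd, Finset.card_union_of_disjoint hd] at h2
  have h3 := adjCount_nonneg G P P
  have h4 : 2 * (#S : ℤ) ≤ adjCount G S (S ∪ P) := by
    rw [adjCount_eq_sum]
    calc 2 * (#S : ℤ) = ∑ u ∈ S, 2 := by simp [mul_comm]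
      _ ≤ _ := Finset.sum_le_sum fun u hu => by have := hcon u hu; omega
  rw [adjCount_union_right G hd] at h4
  push_cast at h2
  omega

theorem IsCliqueTree.mem_clique (hG : TightCircuit G) {U : Finset V} (hU : IsCliqueTree G U)
    {v : V} (hv : v ∈ U) : ∃ K ⊆ U, G.IsNClique 4 K ∧ v ∈ K := by
  obtain ⟨a, ha, b, hb, hab⟩ := hU.critical.exists_adj hG (D := {v})
    ⟨by simpa using hv, fun h => by
      have h1 := Finset.card_le_card h
      have h2 := hU.four_le_card
      rw [Finset.card_singleton] at h1
      omega⟩ (singleton_nonempty v)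
  rw [mem_singleton] at ha
  subst ha
  obtain ⟨K, hKU, hK, h, -⟩ := hU.clique_of_adj a hv b (mem_sdiff.1 hb).1 hab
  exact ⟨K, hKU, hK, h⟩

/-- If the part of a clique tree `U` outside a critical set `A` has only `r` as a neighbour
outside `U`, then all vertices outside `U` lie in a common clique on four vertices. -/
theorem IsPrimeCircuit.exists_isNClique (hG : IsPrimeCircuit G) {U A : Finset V} {r : V}
    (hU : IsCliqueTree G U) (hA : IsCritical G (A ∩ U)) (hUA : ¬ U ⊆ A) (hr : r ∉ U)
    (hadj : ∀ a ∈ U, a ∉ A → ∀ b ∉ U, G.Adj a b → b = r)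
    (hne : ∀ K ⊆ U, G.IsNClique 4 K → ∃ b ∉ K, b ≠ r) :
    ∃ R, G.IsNClique 4 R ∧ ∀ w ∉ U, w ∈ R := by
  obtain ⟨D, K, c, hAD, hK, hi, hu, hn⟩ := hU.exists_leaf hG.tight hA
    ⟨inter_subset_right, fun h => hUA (h.trans inter_subset_left)⟩
  have hKU : K ⊆ U := hu ▸ subset_union_left
  have hc : c ∈ K ∧ c ∈ D := mem_inter.1 (by rw [hi]; simp)
  refine ⟨insert c Kᶜ, ?_, fun w hw => mem_insert_of_mem (mem_compl.2 fun h => hw (hKU h))⟩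
  refine hG.isNClique_of_attached (K := K) (c := c) (r := r) hK ?_ (fun h => hr (hKU h))
    (mem_insert_of_mem (mem_compl.2 fun h => hr (hKU h))) ?_ ?_ ?_
  · ext a
    simp only [mem_inter, mem_insert, mem_compl, mem_singleton]
    constructor
    · tauto
    · rintro rfl
      exact ⟨hc.1, Or.inl rfl⟩
  · ext a
    simp
  -- A vertex of K other than c lies in U \ A, so its edges leaving K go to r: the leaf property
  -- excludes D \ K.
  · intro a ha haR b _ hbK hab
    have hac : a ≠ c := fun h => haR (by simp [h])
    have haD : a ∉ D := fun h => hac (by simpa [hi] using mem_inter.2 ⟨ha, h⟩)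
    have haA : a ∉ A := fun h => haD (hAD (mem_inter.2 ⟨h, hKU ha⟩))
    refine hadj a (hKU ha) haA b (fun hbU => ?_) hab
    have hbD : b ∈ D := by
      rw [← hu, mem_union] at hbU
      exact hbU.resolve_left hbK
    exact hn a ha haD b hbD hbK hab
  · obtain ⟨b, hb, hbr⟩ := hne K hKU hK
    exact ⟨b, by simp [hb], hb, hbr⟩

end Flaps

/-! ### The minimal flap argument. -/

section Main

open Finset

variable {V : Type*} [Fintype V] [DecidableEq V] {G : SimpleGraph V}

/-- Let `u` be a flap node in a set `W` with critical complement that does not consist of nodes.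
If all flaps of `u` properly inside `W` consist of nodes, then `u` has two neighbours in `W` that
are nodes. -/
theorem IsFlapNode.exists_node_neighbors (hG : TightCircuit G) {u : V} (hu : IsFlapNode G u)
    {W : Finset V} (hW : IsCritical G Wᶜ) (huW : u ∈ W) (hWn : ∃ w ∈ W, ¬ IsNode G w)
    (hmin : ∀ x W', IsFlap G u x W' → W' ⊂ W → ∀ w ∈ W', IsNode G w) :
    ∃ a b, a ≠ b ∧ G.Adj u a ∧ G.Adj u b ∧ a ∈ W ∧ b ∈ W ∧ IsNode G a ∧ IsNode G b := by
  by_cases hcase : ∃ a W', a ∈ W ∧ IsFlap G u a W' ∧ W ∪ W' = univ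
  · obtain ⟨a, W', ha, hW', hcov⟩ := hcase
    obtain ⟨b, c, hab, hac, hbc, hN⟩ := hu.1.exists_others hW'.adj
    -- The flap at another neighbour is disjoint from W', hence lies in W, and properly so as it
    -- misses u.
    have key : ∀ b, b ≠ a → G.Adj u b → b ∈ W ∧ IsNode G b := by
      intro b hba hub
      obtain ⟨W₂, hW₂⟩ := hu.2 b hub
      have hd := (hW₂.disjoint hG hu.1 hW' hba).1
      have hsub : W₂ ⊆ W := fun w hw => by
        have : w ∈ W ∪ W' := hcov ▸ mem_univ w
        exact (mem_union.1 this).resolve_right (Finset.disjoint_left.1 hd hw)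
      exact ⟨hsub hW₂.mem, hmin b W₂ hW₂ ⟨hsub, fun h => hW₂.notMem (h huW)⟩ b hW₂.mem⟩
    have hb := (hN b).2 (by simp)
    have hc := (hN c).2 (by simp)
    exact ⟨b, c, hbc, hb, hc, (key b hab.symm hb).1, (key c hac.symm hc).1,
      (key b hab.symm hb).2, (key c hac.symm hc).2⟩
  push Not at hcase
  -- Now the complements of W and W' meet, so W ∩ W' is again a flap of u, and it is smaller than W.
  have hnode : ∀ a, G.Adj u a → a ∈ W → IsNode G a := by
    intro a hua ha
    obtain ⟨W', hW'⟩ := hu.2 a hua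
    have h1 : (W ∩ W')ᶜ = Wᶜ ∪ W'ᶜ := compl_inter W W'
    have hne : (Wᶜ ∩ W'ᶜ).Nonempty := by
      rw [← compl_union, nonempty_iff_ne_empty, Ne, compl_eq_empty_iff]
      exact hcase a W' ha hW'
    have hau : a ∉ Wᶜ ∪ W'ᶜ := by simp [ha, hW'.mem]
    have hcrit := (hW.union_inter hG hW'.critical hne fun h => hau (h ▸ mem_univ a)).1
    refine hmin a (W ∩ W') ⟨mem_inter.2 ⟨ha, hW'.mem⟩, fun h => hW'.notMem (mem_inter.1 h).2, hua,
      h1 ▸ hcrit, fun y hy => hW'.eq_of_adj y (mem_inter.1 hy).2⟩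
      ⟨inter_subset_left, fun h => hW'.notMem (mem_inter.1 (h huW)).2⟩ a
      (mem_inter.2 ⟨ha, hW'.mem⟩)
  obtain ⟨w, hwW, hwn⟩ := hWn
  have huc : u ∉ Wᶜ := by simpa using huW
  -- With only one neighbour of u in W, removing u from W would leave a smaller flap that still
  -- contains the non-node w.
  have one : ∀ x y z, x ≠ y → x ≠ z → y ≠ z → (∀ w, G.Adj u w ↔ w = x ∨ w = y ∨ w = z) →
      x ∈ W → y ∉ W → z ∉ W → False := by
    intro x y z hxy hxz hyz hN hx hy hz
    have hflap := IsFlap.of_critical hxy hxz hyz hN hW huc (by simpa using hx) (by simpa using hy)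
      (by simpa using hz)
    have hwu : w ≠ u := fun h => hwn (h ▸ hu.1)
    refine hwn (hmin x _ hflap ⟨fun a ha => ?_, fun h => ?_⟩ w (by simp [hwu, hwW]))
    · simp at ha
      exact ha.2
    · have := h huW
      simp at this
  obtain ⟨x, y, z, hxy, hxz, hyz, hN⟩ := hu.1.exists_neighbors
  have hux := (hN x).2 (by simp)
  have huy := (hN y).2 (by simp)
  have huz := (hN z).2 (by simp)
  by_cases hx : x ∈ W <;> by_cases hy : y ∈ W <;> by_cases hz : z ∈ W
  · exact ⟨x, y, hxy, hux, huy, hx, hy, hnode x hux hx, hnode y huy hy⟩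
  · exact ⟨x, y, hxy, hux, huy, hx, hy, hnode x hux hx, hnode y huy hy⟩
  · exact ⟨x, z, hxz, hux, huz, hx, hz, hnode x hux hx, hnode z huz hz⟩
  · exact (one x y z hxy hxz hyz hN hx hy hz).elim
  · exact ⟨y, z, hyz, huy, huz, hy, hz, hnode y huy hy, hnode z huz hz⟩
  · exact (one y x z hxy.symm hyz hxz (fun w => by rw [hN]; tauto) hy hx hz).elim
  · exact (one z x y hxz.symm hyz.symm hxy (fun w => by rw [hN]; tauto) hz hx hy).elim
  -- With no neighbour in W, the set W would be {u}, and u is a node.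
  · have h := hW.insert_eq_univ hG huc (by
      rw [adjCount_singleton_eq_ite hxy hxz hyz hN]
      simp [hx, hy, hz])
    have hw := Finset.ext_iff.1 h w
    simp only [mem_insert, mem_compl, mem_univ, iff_true] at hw
    exact absurd ((hw.resolve_right fun h => h hwW) ▸ hu.1) hwn

/-- A set of nodes with critical complement is connected. -/
theorem exists_adj_of_nodes (hG : TightCircuit G) {D : Finset V} (hD : ∀ v ∈ D, IsNode G v)
    (hc : IsCritical G Dᶜ) {x : V} (hx : x ∈ D) (hne : D ≠ {x}) : ∃ b ∈ D, G.Adj x b := by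
  have h1 := adjCount_compl G D D
  have h2 : adjCount G D univ = 3 * #D := by
    rw [adjCount_eq_sum, Finset.sum_congr rfl fun v hv => isNode_iff.1 (hD v hv)]
    simp [mul_comm]
  have h3 := adjCount_self_compl hG D
  have h4 := card_compl_int D
  have h5 := hc.2
  have hxe := Finset.notMem_erase x D
  have h6 := adjCount_insert_self G hxe
  have h7 := card_insert_int hxe
  rw [Finset.insert_erase hx] at h6 h7
  have hne' : (D.erase x).Nonempty := by
    rw [nonempty_iff_ne_empty, Ne, Finset.erase_eq_empty_iff, not_or]
    exact ⟨fun h => by simp [h] at hx, hne⟩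
  have h8 := hG.forest (S := D.erase x) (fun v hv => hD v (mem_of_mem_erase hv)) hne'
  -- Criticality of the complement gives D exactly |D| - 1 edges; D without x carries at most |D| -
  -- 2, so one of them ends at x.
  obtain ⟨a, ha, b, hb, hab⟩ := exists_adj_of_adjCount G (X := {x}) (Y := D.erase x) (by omega)
  rw [mem_singleton] at ha
  exact ⟨b, mem_of_mem_erase hb, ha ▸ hab⟩

theorem IsPrimeCircuit.two_admissible (hG : IsPrimeCircuit G) :
    ∃ u v : V, u ≠ v ∧ IsAdmissibleNode G u ∧ IsAdmissibleNode G v := by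
  classical
  by_contra hcon
  push Not at hcon
  have hT := hG.tight
  let P : Finset V := {v | IsAdmissibleNode G v}
  have hmemP : ∀ v, v ∈ P ↔ IsAdmissibleNode G v := by simp [P]
  have hPnode : ∀ v ∈ P, IsNode G v := fun v hv => ((hmemP v).1 hv).1
  have hPc : #P ≤ 1 := Finset.card_le_one.2 fun a ha b hb => by
    by_contra hab
    exact hcon a b hab ((hmemP a).1 ha) ((hmemP b).1 hb)
  let B : Finset V := {v | IsFlapNode G v ∧ v ∉ P}
  have hmemB : ∀ v, v ∈ B ↔ IsFlapNode G v ∧ v ∉ P := by simp [B]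
  have hBnode : ∀ v ∈ B, IsNode G v := fun v hv => ((hmemB v).1 hv).1.1
  have htype : ∀ v, IsNode G v → (∀ K, G.IsNClique 4 K → v ∉ K) → v ∈ B ∨ v ∈ P := by
    intro v hv hK
    by_cases hvP : v ∈ P
    · exact Or.inr hvP
    · refine Or.inl ((hmemB v).2 ⟨?_, hvP⟩)
      refine (mem_clique_or_isFlapNode hG hv fun h => hvP ((hmemP v).2 h)).resolve_left ?_
      rintro ⟨K, hK', hvK⟩
      exact hK K hK' hvK
  have hnbr : ∀ v, IsFlapNode G v → ∀ a, G.Adj v a → IsNode G a → ∀ K, G.IsNClique 4 K → a ∉ K :=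
    fun v hv a hva ha K hK haK => hv.notMem_clique hT hK (ha.mem_clique hK haK hva.symm)
  have hnbrBP : ∀ v, IsFlapNode G v → ∀ a, G.Adj v a → IsNode G a → a ∈ B ∨ a ∈ P :=
    fun v hv a hva ha => htype a ha (hnbr v hv a hva ha)
  have hforest : ∀ S ⊆ B, S.Nonempty → (∀ u ∈ S, ∃ a b, a ≠ b ∧ G.Adj u a ∧ G.Adj u b ∧
      a ∈ S ∪ P ∧ b ∈ S ∪ P) → False := by
    intro S hSB hne hdeg
    obtain ⟨u, hu, hle⟩ := hT.not_two_le_degree (fun v hv => hBnode v (hSB hv)) hPnode hne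
      (Finset.disjoint_left.2 fun v hv => ((hmemB v).1 (hSB hv)).2) hPc
    obtain ⟨a, b, hab, hua, hub, ha, hb⟩ := hdeg u hu
    have h4 := adjCount_mono G (Subset.refl {u})
      (show ({a, b} : Finset V) ⊆ S ∪ P by
        intro w hw
        rcases mem_insert.1 hw with rfl | hw
        · exact ha
        · exact mem_singleton.1 hw ▸ hb)
    rw [adjCount_singleton_eq_card G (T := {a, b}) (by simp [hua, hub]) Subset.rfl,
      Finset.card_pair hab] at h4
    omega
  rcases B.eq_empty_or_nonempty with hB | hB
  · have h1 := deficiency_le hG (Y := univ) (P := P) (fun U _ _ => subset_univ U)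
      fun v _ hv hK => (htype v hv hK).resolve_left (by simp [hB])
    rw [hT.deficiency_univ] at h1
    omega
  -- A minimal flap that does not consist of nodes.
  have hex : {W : Finset V | (∃ v ∈ B, ∃ x, IsFlap G v x W) ∧ ∃ w ∈ W, ¬ IsNode G w}.Nonempty := by
    -- If all flaps of vertices in B consisted of nodes, all neighbours of these vertices would lie
    -- in B ∪ P, against the forest property.
    by_contra hn
    refine hforest B Subset.rfl hB fun u hu => ?_
    have hu' := ((hmemB u).1 hu).1
    obtain ⟨x, y, z, hxy, -, -, hN⟩ := hu'.1.exists_neighbors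
    have key : ∀ a, G.Adj u a → a ∈ B ∪ P := by
      intro a hua
      obtain ⟨W, hW⟩ := hu'.2 a hua
      refine mem_union.2 (hnbrBP u hu' a hua ?_)
      by_contra ha
      exact hn ⟨W, ⟨u, hu, a, hW⟩, a, hW.mem, ha⟩
    have hx := (hN x).2 (by simp)
    have hy := (hN y).2 (by simp)
    exact ⟨x, y, hxy, hx, hy, key x hx, key y hy⟩
  obtain ⟨W, ⟨⟨v, hvB, x, hW⟩, hWn⟩, hWmin⟩ := (Set.toFinite _).exists_minimal hex
  have hmin : ∀ u ∈ B, ∀ y W', IsFlap G u y W' → W' ⊂ W → ∀ w ∈ W', IsNode G w := by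
    intro u hu y W' hW' hss w hw
    by_contra hwn
    exact hss.2 (hWmin ⟨⟨u, hu, y, hW'⟩, w, hw, hwn⟩ hss.1)
  have hv := ((hmemB v).1 hvB).1
  have hBW : ∀ u ∈ W, u ∉ B := by
    intro u₀ hu₀ hu₀B
    refine hforest (B.filter (· ∈ W)) (filter_subset _ _) ⟨u₀, mem_filter.2 ⟨hu₀B, hu₀⟩⟩ ?_
    intro u hu
    rw [mem_filter] at hu
    have hu' := ((hmemB u).1 hu.1).1
    obtain ⟨a, b, hab, hua, hub, haW, hbW, ha, hb⟩ :=
      hu'.exists_node_neighbors hT hW.critical hu.2 hWn (hmin u hu.1)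
    refine ⟨a, b, hab, hua, hub, ?_, ?_⟩
    · rw [mem_union, mem_filter]
      exact (hnbrBP u hu' a hua ha).imp_left fun h => ⟨h, haW⟩
    · rw [mem_union, mem_filter]
      exact (hnbrBP u hu' b hub hb).imp_left fun h => ⟨h, hbW⟩
  obtain ⟨y, z, hxy, hxz, hyz, hN⟩ := hv.1.exists_others hW.adj
  have hvy := (hN y).2 (by simp)
  have hvz := (hN z).2 (by simp)
  have hdef : 2 ≤ deficiency G W := by
    have h1 := hW.critical.deficiency_compl hT
    rw [compl_compl] at h1
    have hWc : 2 ≤ #Wᶜ := Finset.one_lt_card.2 ⟨v, by simpa using hW.notMem, y, by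
      rw [mem_compl]
      exact fun h => hxy (hW.eq_of_adj y h hvy).symm, hvy.ne⟩
    have hW2 : 2 ≤ #W := by
      -- A single vertex with critical complement has degree three, but W contains a non-node.
      by_contra! hlt
      have hWx : W = {x} := by
        refine (Finset.eq_of_subset_of_card_le (by simpa using hW.mem) ?_).symm
        rw [card_singleton]
        omega
      obtain ⟨w, hw, hwn⟩ := hWn
      rw [hWx, mem_singleton] at hw
      subst hw
      have e1 := adjCount_self_compl hT W
      have e2 := hW.critical.2
      have e3 := card_compl_int W
      have e4 := adjCount_compl G W W
      rw [hWx, adjCount_singleton_self] at e1 e4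
      rw [hWx] at e2 e3
      rw [card_singleton] at e3
      exact hwn (isNode_iff.2 (by omega))
    have := hG.four_le_cut hW.critical hWc (by rwa [compl_compl])
    rw [compl_compl] at this
    omega
  obtain ⟨U, hU, hUW, hUnW⟩ : ∃ U, Maximal (IsCliqueTree G) U ∧ (U ∩ W).Nonempty ∧ ¬ U ⊆ W := by
    by_contra! hn
    have h1 := deficiency_le hG (Y := W) (P := P) hn
      fun u huW hu hK => (htype u hu hK).resolve_left (hBW u huW)
    omega
  have hvU : v ∉ U := by
    intro h
    obtain ⟨K, -, hK, hvK⟩ := hU.1.mem_clique hT h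
    exact hv.notMem_clique hT hK hvK
  have hmeet : (Wᶜ ∩ U).Nonempty := by
    obtain ⟨a, ha, haW⟩ := not_subset.1 hUnW
    exact ⟨a, by simp [ha, haW]⟩
  have hUA : ¬ U ⊆ Wᶜ := by
    obtain ⟨a, ha⟩ := hUW
    rw [mem_inter] at ha
    exact fun h => by simpa [ha.2] using h ha.1
  have hfinish : ¬ ∃ R, G.IsNClique 4 R ∧ ∀ w ∉ U, w ∈ R := by
    rintro ⟨R, hR, h⟩
    exact hv.notMem_clique hT hR (h v hvU)
  apply hfinish
  by_cases hxU : x ∈ U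
  -- The edge vx joins the differences of the critical sets Wᶜ and U. So these cover V, and vx is
  -- the only such edge: r = v is the only exit from U \ Wᶜ.
  · have hd := adjCount_pos G (X := Wᶜ \ U) (Y := U \ Wᶜ) (by simp [hW.notMem, hvU])
      (by simp [hxU, hW.mem]) hW.adj
    have hcov : Wᶜ ∪ U = univ := by
      by_contra hn
      have := (hW.critical.union_inter hT hU.1.critical hmeet hn).2.2
      omega
    obtain ⟨hcrit, h1⟩ := hW.critical.inter_of_cover hT hU.1.critical hmeet hcov hd
    refine hG.exists_isNClique (r := v) hU.1 hcrit hUA hvU (fun a haU haA b hbU hab => ?_)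
      fun K _ hK => ?_
    · have hbA : b ∈ Wᶜ := by
        have : b ∈ Wᶜ ∪ U := hcov ▸ mem_univ b
        exact (mem_union.1 this).resolve_right hbU
      exact (eq_of_adjCount_eq_one h1 (mem_sdiff.2 ⟨by simpa using hW.notMem, hvU⟩)
        (mem_sdiff.2 ⟨hxU, by simpa using hW.mem⟩) hW.adj (mem_sdiff.2 ⟨hbA, hbU⟩)
        (mem_sdiff.2 ⟨haU, haA⟩) hab.symm).1
    · by_cases hy : y ∈ K
      · exact ⟨z, fun hz => hv.not_adj hT hvy hvz (hK.isClique hy hz hyz), hvz.ne'⟩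
      · exact ⟨y, hy, hvy.ne'⟩
  · have hxA : x ∉ Wᶜ ∪ U := by simp [hW.mem, hxU]
    obtain ⟨hcu, hci, hd⟩ := hW.critical.union_inter hT hU.1.critical hmeet fun h =>
      hxA (h ▸ mem_univ x)
    have hcompl : (W \ U)ᶜ = Wᶜ ∪ U := by ext; simp; tauto
    have hflap : IsFlap G v x (W \ U) := ⟨mem_sdiff.2 ⟨hW.mem, hxU⟩,
      fun h => hW.notMem (mem_sdiff.1 h).1, hW.adj, hcompl ▸ hcu,
      fun y hy => hW.eq_of_adj y (mem_sdiff.1 hy).1⟩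
    -- By minimality the smaller flap W \ U consists of nodes. Both x and any neighbour of x in it
    -- must be admissible, so W \ U = {x}, and r = x is the only exit from U \ Wᶜ.
    have hnodes := hmin v hvB x (W \ U) hflap ⟨sdiff_subset, fun h => by
      obtain ⟨a, ha⟩ := hUW
      rw [mem_inter] at ha
      exact (mem_sdiff.1 (h ha.2)).2 ha.1⟩
    have hxnode := hnodes x hflap.mem
    have hxP : x ∈ P := (hnbrBP v hv x hW.adj hxnode).resolve_left (hBW x hW.mem)
    have hsingle : W \ U = {x} := by
      by_contra hne
      obtain ⟨b, hb, hxb⟩ := exists_adj_of_nodes hT hnodes (hcompl ▸ hcu) hflap.mem hne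
      have hbP : b ∈ P := (htype b (hnodes b hb) fun K hK hbK =>
        hnbr v hv x hW.adj hxnode K hK ((hnodes b hb).mem_clique hK hbK hxb.symm)).resolve_left
          (hBW b (mem_sdiff.1 hb).1)
      exact hxb.ne (Finset.card_le_one.1 hPc x hxP b hbP)
    refine hG.exists_isNClique (r := x) hU.1 hci hUA hxU (fun a haU haA b hbU hab => ?_)
      fun K hKU _ => ⟨v, fun h => hvU (hKU h), hW.adj.ne⟩
    by_cases hbW : b ∈ W
    · simpa [hsingle] using mem_sdiff.2 ⟨hbW, hbU⟩
    · exact absurd hab.symm (not_adj_of_adjCount G hd.le (mem_sdiff.2 ⟨by simpa using hbW, hbU⟩)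
        (mem_sdiff.2 ⟨haU, haA⟩))

end Main

theorem theorem2p2 {V : Type*} [Finite V] (G : SimpleGraph V)
    (hG : IsCircuit22 G)
    (hK : IsEmpty (G ≃g K5e)) (h1 : IsEmpty (G ≃g graphH1)) (h2 : IsEmpty (G ≃g graphH2))
    (hvert : ¬ ∃ F₁ F₂ : G.Subgraph, IsNontrivialTwoVertexSeparation G F₁ F₂)
    (hedge : ¬ ∃ F₁ F₂ : G.Subgraph, IsNontrivialThreeEdgeSeparation G F₁ F₂) :
    ∃ u v : V, u ≠ v ∧ IsAdmissibleNode G u ∧ IsAdmissibleNode G v := by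
  classical
  have := Fintype.ofFinite V
  have hT := hG.tightCircuit
  exact IsPrimeCircuit.two_admissible
    { tight := hT
      sep := fun X Y hu hi hXY hX hY => isNClique_of_no_two_separation hvert hu hi hXY hX hY
      cut := fun X hX => exists_cover_of_no_three_separation hedge hX
      inter := fun K L hKc hLc hne => card_inter_le_one hT hK h1 hKc hLc hne
      union := fun K L hKc hLc hc => union_ne_univ hT h2 hKc hLc hc }
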